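/- Let $(\mathcal X,\rho)$ be a Polish space (a separable complete metric space), let $T=\mathbb N_+=\{1,2,\dots\}$ or $T=\mathbb R_+=[0,\infty)$, and let $\{P_t\}_{t\in T}$ be a Markov–Feller semigroup on $\mathcal X$: a semigroup of positively linear, mass-preserving maps $P_t$ on the finite Borel measures, each having a dual linear operator, also written $P_t$, on the bounded Borel functions ($\langle f,P_t\mu\rangle=\langle P_tf,\mu\rangle$) that maps bounded continuous functions to bounded continuous functions. If $T=\mathbb R_+$, assume in addition that the semigroup is strongly continuous: $\lim_{t\searrow0}\|P_tf-f\|_\infty=0$ for every bounded continuous $f$. Let $\mu$ be an ergodic measure for $\{P_t\}_{t\in T}$, i.e. a probability measure with $P_t\mu=\mu$ for all $t\in T$ such that $\mu(A)\in\{0,1\}$ for every Borel set $A$ with $P_t\mathbf 1_A=\mathbf 1_A$ $\mu$-a.e. for all $t\in T$. Put $\mathcal X_\mu=\operatorname{supp}\mu$, with the metric $\rho$. A semigroup $\{P_t\}_{t\in T}$ has the e-property at $z$ if for every bounded Lipschitz function $f$ and every $\epsilon>0$ there is $\delta>0$ with $|P_tf(x)-P_tf(z)|<\epsilon$ for all $x\in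 B(z,\delta)$ and all $t\in T$. It is eventually continuous at $z$ if for every bounded Lipschitz $f$ and every $\epsilon>0$ there is $\delta>0$ such that for every $x\in B(z,\delta)$ there is $t_x\in T$ with $|P_tf(x)-P_tf(z)|<\epsilon$ for all $t\ge t_x$. It has one of these properties on a space if it has it at every point of the space. Then: 1. $P_t\delta_x(\mathcal X_\mu)=1$ for all $x\in\mathcal X_\mu$ and $t\in T$, and $\{P_t\}_{t\in T}$ restricts to a Markov–Feller semigroup on $\mathcal X_\mu$. 2. If $\{P_t\}_{t\in T}$ is eventually continuous on $\mathcal X$, then the restricted semigroup has the e-property on $\mathcal X_\mu$. 3. The restricted semigroup is eventually continuous on $\mathcal X_\mu$ if and only if it has the e-property on $\mathcal X_\mu$. -/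

import Mathlib

open MeasureTheory Filter Topology
open scoped NNReal BoundedContinuousFunction

namespace MarkovFeller

noncomputable section

/-- The Dirac mass at `x`, as a finite measure. -/
def diracFM {X : Type*} [MeasurableSpace X] (x : X) : FiniteMeasure X :=
  (diracProba x).toFiniteMeasure

/-- The space `B_b(X)` of bounded Borel real-valued functions. -/
def Bb (X : Type*) [MeasurableSpace X] : Submodule ℝ (X → ℝ) where
  carrier := {f | Measurable f ∧ ∃ C : ℝ, ∀ x, |f x| ≤ C}
  add_mem' := by
    rintro f g ⟨hf, C, hC⟩ ⟨hg, D, hD⟩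
    exact ⟨hf.add hg, C + D, fun x => (abs_add_le _ _).trans (add_le_add (hC x) (hD x))⟩
  zero_mem' := ⟨measurable_const, 0, fun x => by simp⟩
  smul_mem' := by
    rintro c f ⟨hf, C, hC⟩
    refine ⟨hf.const_smul c, |c| * C, fun x => ?_⟩
    simp only [Pi.smul_apply, smul_eq_mul, abs_mul]
    exact mul_le_mul_of_nonneg_left (hC x) (abs_nonneg c)

/-- Markov operators on the finite Borel measures: positively linear and mass preserving. -/
structure IsMarkovOperator {X : Type*} [MeasurableSpace X]
    (P : FiniteMeasure X → FiniteMeasure X) : Prop where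
  linear : ∀ (a b : ℝ≥0) (μ ν : FiniteMeasure X), P (a • μ + b • ν) = a • P μ + b • P ν
  mass : ∀ μ : FiniteMeasure X, (P μ).mass = μ.mass

/-- `U` is a dual operator of `P`: `⟨f, P μ⟩ = ⟨U f, μ⟩` for all `f ∈ B_b(X)` and all finite
measures `μ`. -/
def IsDual {X : Type*} [MeasurableSpace X]
    (P : FiniteMeasure X → FiniteMeasure X) (U : Bb X →ₗ[ℝ] Bb X) : Prop :=
  ∀ (f : Bb X) (μ : FiniteMeasure X),
    ∫ x, (f : X → ℝ) x ∂(P μ : Measure X) = ∫ x, (U f : X → ℝ) x ∂(μ : Measure X)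

/-- The function `P f`, given by `(P f)(x) = ⟨f, P δ_x⟩`; see `IsDual.apply_eq`. -/
def act {X : Type*} [MeasurableSpace X]
    (P : FiniteMeasure X → FiniteMeasure X) (f : X → ℝ) (x : X) : ℝ :=
  ∫ y, f y ∂(P (diracFM x) : Measure X)

/-- The dual operator, if there is one, is `act P`. -/
theorem IsDual.apply_eq {X : Type*} [MeasurableSpace X]
    {P : FiniteMeasure X → FiniteMeasure X} {U : Bb X →ₗ[ℝ] Bb X}
    (h : IsDual P U) (f : Bb X) : (U f : X → ℝ) = act P (f : X → ℝ) := by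
  funext x
  have h1 := h f (diracFM x)
  have h2 : (diracFM x : Measure X) = Measure.dirac x := rfl
  rw [h2, integral_dirac' _ _ (U f).2.1.stronglyMeasurable] at h1
  exact h1.symm

/-- Markov-Feller operators: regular Markov operators (the dual operator exists) whose dual
leaves `C_b(X)` invariant. -/
structure IsMarkovFellerOperator {X : Type*} [TopologicalSpace X] [MeasurableSpace X]
    (P : FiniteMeasure X → FiniteMeasure X) : Prop where
  markov : IsMarkovOperator P
  regular : ∃ U : Bb X →ₗ[ℝ] Bb X, IsDual P U
  feller : ∀ f : X →ᵇ ℝ, Continuous (act P f)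

/-- Markov-Feller semigroups indexed by `T` (for us, `T = ℕ+` or `T = ℝ≥0`). If `T` has a
neutral element, it acts as the identity. -/
structure IsMarkovFellerSemigroup {X : Type*} [TopologicalSpace X] [MeasurableSpace X]
    {T : Type*} [Add T] (P : T → FiniteMeasure X → FiniteMeasure X) : Prop where
  operator : ∀ t, IsMarkovFellerOperator (P t)
  neutral : ∀ e : T, (∀ t, e + t = t) → ∀ μ, P e μ = μ
  add : ∀ s t μ, P (s + t) μ = P s (P t μ)

/-- Strong continuity on `C_b(X)`: `‖P_t f - f‖_∞ → 0` as `t ↘ 0`, for every `f ∈ C_b(X)`. -/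
def StronglyContinuous {X : Type*} [TopologicalSpace X] [MeasurableSpace X]
    (P : ℝ≥0 → FiniteMeasure X → FiniteMeasure X) : Prop :=
  ∀ f : X →ᵇ ℝ, TendstoUniformly (fun t => act (P t) f) f (𝓝[>] 0)

/-- Bounded Lipschitz functions, the space `L_b(X)`. -/
def IsBoundedLipschitz {X : Type*} [PseudoMetricSpace X] (f : X → ℝ) : Prop :=
  (∃ K : ℝ≥0, LipschitzWith K f) ∧ ∃ C : ℝ, ∀ x, |f x| ≤ C

/-- The e-property at `z`. -/
def EPropertyAt {X : Type*} [PseudoMetricSpace X] [MeasurableSpace X]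
    {T : Type*} (P : T → FiniteMeasure X → FiniteMeasure X) (z : X) : Prop :=
  ∀ f : X → ℝ, IsBoundedLipschitz f → ∀ ε > 0, ∃ δ > 0, ∀ x ∈ Metric.ball z δ, ∀ t,
    |act (P t) f x - act (P t) f z| < ε

/-- Eventual continuity at `z`. -/
def EventuallyContinuousAt {X : Type*} [PseudoMetricSpace X] [MeasurableSpace X]
    {T : Type*} [LE T] (P : T → FiniteMeasure X → FiniteMeasure X) (z : X) : Prop :=
  ∀ f : X → ℝ, IsBoundedLipschitz f → ∀ ε > 0, ∃ δ > 0, ∀ x ∈ Metric.ball z δ,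
    ∃ t₀ : T, ∀ t, t₀ ≤ t → |act (P t) f x - act (P t) f z| < ε

/-- Ergodic measures: invariant probability measures `μ` such that every Borel set `A` with
`P_t 1_A = 1_A` `μ`-a.e. for all `t` has `μ`-measure `0` or `1`. -/
structure IsErgodicMeasure {X : Type*} [MeasurableSpace X]
    {T : Type*} (P : T → FiniteMeasure X → FiniteMeasure X) (μ : ProbabilityMeasure X) :
    Prop where
  invariant : ∀ t, P t μ.toFiniteMeasure = μ.toFiniteMeasure
  trivial : ∀ A : Set X, MeasurableSet A →
    (∀ t, act (P t) (A.indicator 1) =ᵐ[(μ : Measure X)] A.indicator 1) →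
    (μ : Measure X) A = 0 ∨ (μ : Measure X) A = 1

/-- The restriction of a family of operators to a subset `S`: extend a measure on `S` by zero to
`X`, apply `P_t`, and take the trace on `S`. -/
def restrictTo {X : Type*} [MeasurableSpace X] {T : Type*}
    (P : T → FiniteMeasure X → FiniteMeasure X) (S : Set X) :
    T → FiniteMeasure S → FiniteMeasure S :=
  fun t ν => (P t (ν.map Subtype.val)).comap Subtype.val

end

end MarkovFeller

open MarkovFeller

/-!
The support `S` of `μ` is absorbing: `P_t (min 1 (dist · S))` is continuous, nonnegative and has
`μ`-integral zero, hence vanishes on `S` (`IsMarkovFellerOperator.apply_compl_support`). So the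
semigroup restricts to `S`, where `μ` is an ergodic measure of full support, and continuity
properties pass to the restriction by extending functions from `S` to `X`.

It remains to show, for an ergodic measure `μ` of full support, that eventual continuity at every
point implies the e-property (`ePropertyAt_of_eventuallyContinuous`). Fix a bounded Lipschitz
function `f` and a point `z`.

* Baire's theorem gives an open set `U` on which all `P_t f` with `t` late are nearly constant in
  space (`EventuallyContinuousAt.exists_isOpen`).
* Every finite measure brings a fixed fraction of its mass into `U` at some time
  (`exists_time_le_integral`). Indeed, by a mean ergodic theorem, suitable convex combinations of
  the functions `P_t φ`, with `φ` a bump function in `U` and `t` late, converge to `∫ φ dμ > 0`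
  almost everywhere, hence on a dense set, and by eventual continuity everywhere.
* Start from `δ_x` with `x` near `z`. Run the semigroup until the fixed fraction of the mass coming
  from `δ_z` is in `U`, set that part aside, and repeat with the rest. By the Feller property each
  split depends continuously on `x`. The parts set aside contribute almost the same to `P_t f(x)`
  and `P_t f(z)`, and after finitely many steps the rest is negligible
  (`exists_time_abs_integral_sub_le`). This bounds `|P_t f(x) - P_t f(z)|` for all late `t`.
* The remaining bounded set of times is covered by the Feller property and, in continuous time,
  strong continuity (`ShortTimeEquicontinuous`).
-/

namespace MarkovFeller

/-! ### Bounded Borel functions and the dual operator -/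

section Basic

variable {X : Type*} [MeasurableSpace X]

theorem Bb.integrable {f : X → ℝ} (hf : f ∈ Bb X) (ν : Measure X) [IsFiniteMeasure ν] :
    Integrable f ν := by
  obtain ⟨hm, C, hC⟩ := hf
  exact Integrable.of_bound hm.aestronglyMeasurable C (ae_of_all _ hC)

theorem Bb.const (c : ℝ) : (fun _ => c : X → ℝ) ∈ Bb X :=
  ⟨measurable_const, |c|, fun _ => le_rfl⟩

theorem Bb.abs {f : X → ℝ} (hf : f ∈ Bb X) : (fun x => |f x|) ∈ Bb X := by
  obtain ⟨hm, C, hC⟩ := hf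
  exact ⟨hm.abs, C, fun x => by simpa using hC x⟩

theorem Bb.mul {f g : X → ℝ} (hf : f ∈ Bb X) (hg : g ∈ Bb X) : (fun x => f x * g x) ∈ Bb X := by
  obtain ⟨hm, C, hC⟩ := hf
  obtain ⟨hm', D, hD⟩ := hg
  refine ⟨hm.mul hm', C * D, fun x => ?_⟩
  rw [abs_mul]
  exact mul_le_mul (hC x) (hD x) (abs_nonneg _) ((abs_nonneg _).trans (hC x))

theorem Bb.max {f g : X → ℝ} (hf : f ∈ Bb X) (hg : g ∈ Bb X) :
    (fun x => max (f x) (g x)) ∈ Bb X := by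
  obtain ⟨hm, C, hC⟩ := hf
  obtain ⟨hm', D, hD⟩ := hg
  refine ⟨hm.max hm', Max.max C D, fun x => ?_⟩
  exact abs_max_le_max_abs_abs.trans (max_le_max (hC x) (hD x))

theorem Bb.min {f g : X → ℝ} (hf : f ∈ Bb X) (hg : g ∈ Bb X) :
    (fun x => min (f x) (g x)) ∈ Bb X := by
  obtain ⟨hm, C, hC⟩ := hf
  obtain ⟨hm', D, hD⟩ := hg
  refine ⟨hm.min hm', Max.max C D, fun x => ?_⟩
  exact abs_min_le_max_abs_abs.trans (max_le_max (hC x) (hD x))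

theorem Bb.indicator {A : Set X} (hA : MeasurableSet A) : (A.indicator 1 : X → ℝ) ∈ Bb X := by
  refine ⟨measurable_one.indicator hA, 1, fun x => ?_⟩
  by_cases hx : x ∈ A <;> simp [hx]

theorem Bb.of_boundedContinuous [TopologicalSpace X] [OpensMeasurableSpace X] (f : X →ᵇ ℝ) :
    (f : X → ℝ) ∈ Bb X :=
  ⟨f.continuous.measurable, ‖f‖, fun x => by simpa using f.norm_coe_le_norm x⟩

/-- The square of a mean is at most the mean square. -/
theorem sq_integral_le {f : X → ℝ} (hf : f ∈ Bb X) (ν : Measure X) [IsProbabilityMeasure ν] :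
    (∫ x, f x ∂ν) ^ 2 ≤ ∫ x, f x ^ 2 ∂ν := by
  set a := ∫ x, f x ∂ν with ha
  have h2 : Integrable (fun x => f x ^ 2) ν := by
    simpa [sq] using Bb.integrable (Bb.mul hf hf) ν
  have h1 := Bb.integrable hf ν
  have h0 : 0 ≤ ∫ x, (f x ^ 2 - 2 * a * f x + a ^ 2) ∂ν :=
    integral_nonneg fun x => by
      have : f x ^ 2 - 2 * a * f x + a ^ 2 = (f x - a) ^ 2 := by ring
      simp only [Pi.zero_apply, this]
      positivity
  have h3 : Integrable (fun x => 2 * a * f x) ν := h1.const_mul _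
  have h4 : Integrable (fun x => f x ^ 2 - 2 * a * f x) ν := h2.sub h3
  rw [integral_add h4 (integrable_const _), integral_sub h2 h3, integral_const_mul, ← ha] at h0
  simp only [integral_const, probReal_univ, smul_eq_mul, one_mul] at h0
  nlinarith

end Basic

section Operator

variable {X : Type*} [TopologicalSpace X] [MeasurableSpace X]
  {P : FiniteMeasure X → FiniteMeasure X}

namespace IsMarkovFellerOperator

theorem act_mem (hP : IsMarkovFellerOperator P) {f : X → ℝ} (hf : f ∈ Bb X) : act P f ∈ Bb X := by
  obtain ⟨U, hU⟩ := hP.regular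
  rw [← hU.apply_eq ⟨f, hf⟩]
  exact (U ⟨f, hf⟩).2

theorem integral_eq (hP : IsMarkovFellerOperator P) {f : X → ℝ} (hf : f ∈ Bb X)
    (ν : FiniteMeasure X) :
    ∫ x, f x ∂(P ν : Measure X) = ∫ x, act P f x ∂(ν : Measure X) := by
  obtain ⟨U, hU⟩ := hP.regular
  rw [← hU.apply_eq ⟨f, hf⟩]
  exact hU ⟨f, hf⟩ ν

theorem isProbabilityMeasure (hP : IsMarkovFellerOperator P) (x : X) :
    IsProbabilityMeasure (P (diracFM x) : Measure X) := by
  constructor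
  rw [← FiniteMeasure.ennreal_mass, hP.markov.mass, FiniteMeasure.ennreal_mass]
  change Measure.dirac x Set.univ = 1
  simp

theorem act_mono (hP : IsMarkovFellerOperator P) {f g : X → ℝ} (hf : f ∈ Bb X) (hg : g ∈ Bb X)
    (h : ∀ x, f x ≤ g x) (x : X) : act P f x ≤ act P g x := by
  have := hP.isProbabilityMeasure x
  exact integral_mono (Bb.integrable hf _) (Bb.integrable hg _) h

theorem act_const (hP : IsMarkovFellerOperator P) (c : ℝ) (x : X) :
    act P (fun _ => c) x = c := by
  have := hP.isProbabilityMeasure x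
  simp [act]

theorem act_add (_hP : IsMarkovFellerOperator P) {f g : X → ℝ} (hf : f ∈ Bb X) (hg : g ∈ Bb X)
    (x : X) : act P (fun y => f y + g y) x = act P f x + act P g x :=
  integral_add (Bb.integrable hf _) (Bb.integrable hg _)

theorem act_sub (_hP : IsMarkovFellerOperator P) {f g : X → ℝ} (hf : f ∈ Bb X) (hg : g ∈ Bb X)
    (x : X) : act P (fun y => f y - g y) x = act P f x - act P g x :=
  integral_sub (Bb.integrable hf _) (Bb.integrable hg _)

theorem act_const_mul (_hP : IsMarkovFellerOperator P) (c : ℝ) (f : X → ℝ) (x : X) :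
    act P (fun y => c * f y) x = c * act P f x :=
  integral_const_mul _ _

theorem abs_act_le_of_abs_le (hP : IsMarkovFellerOperator P) {f : X → ℝ} (hf : f ∈ Bb X) {C : ℝ}
    (hC : ∀ x, |f x| ≤ C) (x : X) : |act P f x| ≤ C := by
  rw [abs_le]
  constructor
  · rw [← hP.act_const (-C) x]
    exact hP.act_mono (Bb.const _) hf (fun y => (abs_le.1 (hC y)).1) x
  · rw [← hP.act_const C x]
    exact hP.act_mono hf (Bb.const _) (fun y => (abs_le.1 (hC y)).2) x

theorem abs_act_le (_hP : IsMarkovFellerOperator P) (f : X → ℝ) (x : X) :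
    |act P f x| ≤ act P (fun y => |f y|) x :=
  abs_integral_le_integral_abs

theorem sq_act_le (hP : IsMarkovFellerOperator P) {f : X → ℝ} (hf : f ∈ Bb X) (x : X) :
    act P f x ^ 2 ≤ act P (fun y => f y ^ 2) x := by
  have := hP.isProbabilityMeasure x
  exact sq_integral_le hf _

/-- If `μ` is invariant, a function with `w ≤ P w` almost everywhere satisfies `P w = w` almost
everywhere, since both sides have the same integral. -/
theorem act_ae_eq_of_le (hP : IsMarkovFellerOperator P) {μ : FiniteMeasure X} (hμ : P μ = μ)
    {w : X → ℝ} (hw : w ∈ Bb X) (h : w ≤ᵐ[(μ : Measure X)] act P w) :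
    act P w =ᵐ[(μ : Measure X)] w := by
  refine ((integral_eq_iff_of_ae_le (Bb.integrable hw _) (Bb.integrable (hP.act_mem hw) _) h).1
    ?_).symm
  rw [← hP.integral_eq hw, hμ]

theorem act_ae_eq_of_ge (hP : IsMarkovFellerOperator P) {μ : FiniteMeasure X} (hμ : P μ = μ)
    {w : X → ℝ} (hw : w ∈ Bb X) (h : act P w ≤ᵐ[(μ : Measure X)] w) :
    act P w =ᵐ[(μ : Measure X)] w := by
  refine ((integral_eq_iff_of_ae_le (Bb.integrable (hP.act_mem hw) _) (Bb.integrable hw _) h).1 ?_)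
  rw [← hP.integral_eq hw, hμ]

/-- Superlevel sets of almost everywhere invariant functions are almost everywhere invariant. The
indicator of `{h > c}` is the increasing limit of `min 1 (n (h - c)⁺)`, and both truncations
preserve invariance by `act_ae_eq_of_le` and `act_ae_eq_of_ge`. -/
theorem act_indicator_superlevel (hP : IsMarkovFellerOperator P) {μ : FiniteMeasure X}
    (hμ : P μ = μ) {h : X → ℝ} (hh : h ∈ Bb X) (hinv : act P h =ᵐ[(μ : Measure X)] h) (c : ℝ) :
    act P ({x | c < h x}.indicator 1) =ᵐ[(μ : Measure X)] {x | c < h x}.indicator 1 := by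
  set u : X → ℝ := fun x => max (h x - c) 0 with hu
  have hhc : (fun x => h x - c) ∈ Bb X := (Bb X).sub_mem hh (Bb.const c)
  have humem : u ∈ Bb X := Bb.max hhc (Bb.const 0)
  have hu_inv : act P u =ᵐ[(μ : Measure X)] u := by
    refine hP.act_ae_eq_of_le hμ humem ?_
    filter_upwards [hinv] with x hx
    refine max_le ?_ ?_
    · rw [← hx, show act P h x - c = act P (fun y => h y - c) x by
        rw [hP.act_sub hh (Bb.const c), hP.act_const]]
      exact hP.act_mono hhc humem (fun y => le_max_left _ _) x
    · rw [← hP.act_const 0 x]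
      exact hP.act_mono (Bb.const 0) humem (fun y => le_max_right _ _) x
  set v : ℕ → X → ℝ := fun n x => min 1 (n * u x) with hv
  have hnu : ∀ n : ℕ, (fun x => (n : ℝ) * u x) ∈ Bb X := fun n => Bb.mul (Bb.const _) humem
  have hvmem : ∀ n, v n ∈ Bb X := fun n => Bb.min (Bb.const 1) (hnu n)
  have hv_inv : ∀ n, act P (v n) =ᵐ[(μ : Measure X)] v n := by
    intro n
    refine hP.act_ae_eq_of_ge hμ (hvmem n) ?_
    filter_upwards [hu_inv] with x hx
    refine le_min ?_ ?_
    · exact (hP.act_mono (hvmem n) (Bb.const 1) (fun y => min_le_left _ _) x).trans_eq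
        (hP.act_const 1 x)
    · rw [← hx, ← hP.act_const_mul]
      exact hP.act_mono (hvmem n) (hnu n) (fun y => min_le_right _ _) x
  have hlim : ∀ x, Tendsto (fun n => v n x) atTop (𝓝 (({x | c < h x}.indicator 1 : X → ℝ) x)) := by
    intro x
    by_cases hx : c < h x
    · have hux : 0 < u x := by simp [hu, hx]
      rw [Set.indicator_of_mem (by exact hx)]
      refine tendsto_const_nhds.congr' ?_
      have : Tendsto (fun n : ℕ => (n : ℝ) * u x) atTop atTop :=
        tendsto_natCast_atTop_atTop.atTop_mul_const hux
      filter_upwards [this.eventually_ge_atTop 1] with n hn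
      simp [hv, hn]
    · have hux : u x = 0 := by simp only [hu]; exact max_eq_right (by linarith)
      rw [Set.indicator_of_notMem (by exact hx)]
      simp [hv, hux]
  filter_upwards [ae_all_iff.2 hv_inv] with x hx
  refine tendsto_nhds_unique ?_ (hlim x)
  simp only [← hx]
  have := hP.isProbabilityMeasure x
  refine tendsto_integral_of_dominated_convergence (fun _ => 1)
    (fun n => (hvmem n).1.aestronglyMeasurable) (integrable_const _) (fun n => ae_of_all _ ?_)
    (ae_of_all _ hlim)
  intro y
  have : 0 ≤ (n : ℝ) * u y := mul_nonneg n.cast_nonneg (le_max_right _ _)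
  rw [Real.norm_eq_abs, abs_of_nonneg (le_min zero_le_one this)]
  exact min_le_left _ _

end IsMarkovFellerOperator

theorem IsMarkovFellerSemigroup.act_add {T : Type*} [Add T]
    {P : T → FiniteMeasure X → FiniteMeasure X} (hP : IsMarkovFellerSemigroup P) (s t : T)
    {f : X → ℝ} (hf : f ∈ Bb X) : act (P (s + t)) f = act (P t) (act (P s) f) := by
  funext x
  rw [act, hP.add, (hP.operator s).integral_eq hf]
  rfl

/-- For an ergodic measure, bounded functions invariant under the whole semigroup are almost
everywhere equal to their mean. -/
theorem IsErgodicMeasure.ae_eq_integral {T : Type*} [Add T]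
    {P : T → FiniteMeasure X → FiniteMeasure X} (hP : IsMarkovFellerSemigroup P)
    {μ : ProbabilityMeasure X} (hμ : IsErgodicMeasure P μ) {h : X → ℝ} (hh : h ∈ Bb X)
    (hinv : ∀ t, act (P t) h =ᵐ[(μ : Measure X)] h) :
    h =ᵐ[(μ : Measure X)] fun _ => ∫ x, h x ∂(μ : Measure X) := by
  set c := ∫ x, h x ∂(μ : Measure X) with hc
  have hA : MeasurableSet {x | c < h x} := measurableSet_lt measurable_const hh.1
  have hint : Integrable h (μ : Measure X) := Bb.integrable hh _
  have hcint : Integrable (fun _ => c : X → ℝ) (μ : Measure X) := integrable_const _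
  have heq : ∫ _, c ∂(μ : Measure X) = c := by simp
  have hor := hμ.trivial _ hA fun t =>
    (hP.operator t).act_indicator_superlevel (hμ.invariant t) hh (hinv t) c
  rcases hor with h0 | h1
  · have hle : h ≤ᵐ[(μ : Measure X)] fun _ => c := by
      rw [EventuallyLE, ae_iff]
      simpa only [not_le] using h0
    exact (integral_eq_iff_of_ae_le hint hcint hle).1 (by rw [heq])
  · have hlt : ∀ᵐ x ∂(μ : Measure X), c < h x := (prob_compl_eq_zero_iff hA).2 h1
    exact ((integral_eq_iff_of_ae_le hcint hint (hlt.mono fun x hx => hx.le)).1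
      (by rw [heq])).symm

end Operator

/-! ### Mean ergodic theorem -/

section MeanErgodic

variable {X : Type*} [MeasurableSpace X] {T : Type*} {P : T → FiniteMeasure X → FiniteMeasure X}

/-- Finite convex combinations of the functions `P_t f` with `t ≥ s`. -/
def tailHull [LE T] (P : T → FiniteMeasure X → FiniteMeasure X) (f : X → ℝ) (s : T) : Set (X → ℝ) :=
  convexHull ℝ {g | ∃ t, s ≤ t ∧ g = act (P t) f}

/-- Finite convex combinations of the functions `P_t f`. -/
def orbitHull (P : T → FiniteMeasure X → FiniteMeasure X) (f : X → ℝ) : Set (X → ℝ) :=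
  convexHull ℝ {g | ∃ t, g = act (P t) f}

theorem tailHull_subset_orbitHull [LE T] (f : X → ℝ) (s : T) : tailHull P f s ⊆ orbitHull P f :=
  convexHull_mono fun _ ⟨t, _, ht⟩ => ⟨t, ht⟩

theorem orbitHull_mem_bounded [TopologicalSpace X] [Add T]
    (hP : IsMarkovFellerSemigroup P) {f : X → ℝ} (hf : f ∈ Bb X) {C : ℝ}
    (hC : ∀ x, |f x| ≤ C) {g : X → ℝ} (hg : g ∈ orbitHull P f) : g ∈ Bb X ∧ ∀ x, |g x| ≤ C := by
  have hsub : orbitHull P f ⊆ {g | g ∈ Bb X ∧ ∀ x, |g x| ≤ C} := by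
    refine convexHull_min ?_ ?_
    · rintro _ ⟨t, rfl⟩
      exact ⟨(hP.operator t).act_mem hf, (hP.operator t).abs_act_le_of_abs_le hf hC⟩
    · rintro g ⟨hg, hgC⟩ g' ⟨hg', hgC'⟩ a b ha hb hab
      refine ⟨(Bb X).add_mem ((Bb X).smul_mem a hg) ((Bb X).smul_mem b hg'), fun x => ?_⟩
      have h1 := abs_le.1 (hgC x)
      have h2 := abs_le.1 (hgC' x)
      simp only [Pi.add_apply, Pi.smul_apply, smul_eq_mul, abs_le]
      obtain rfl : b = 1 - a := by linarith
      constructor <;> nlinarith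
  exact hsub hg

theorem integral_orbitHull [TopologicalSpace X] [Add T]
    (hP : IsMarkovFellerSemigroup P) {μ : ProbabilityMeasure X}
    (hμ : ∀ t, P t μ.toFiniteMeasure = μ.toFiniteMeasure) {f : X → ℝ} (hf : f ∈ Bb X)
    {g : X → ℝ} (hg : g ∈ orbitHull P f) :
    ∫ x, g x ∂(μ : Measure X) = ∫ x, f x ∂(μ : Measure X) := by
  have hsub : orbitHull P f ⊆
      {g | g ∈ Bb X ∧ ∫ x, g x ∂(μ : Measure X) = ∫ x, f x ∂(μ : Measure X)} := by
    refine convexHull_min ?_ ?_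
    · rintro _ ⟨t, rfl⟩
      refine ⟨(hP.operator t).act_mem hf, ?_⟩
      have := (hP.operator t).integral_eq hf μ.toFiniteMeasure
      rw [hμ] at this
      exact this.symm
    · rintro g ⟨hg, hgC⟩ g' ⟨hg', hgC'⟩ a b ha hb hab
      refine ⟨(Bb X).add_mem ((Bb X).smul_mem a hg) ((Bb X).smul_mem b hg'), ?_⟩
      simp only [Pi.add_apply, Pi.smul_apply, smul_eq_mul]
      rw [integral_add ((Bb.integrable hg _).const_mul _) ((Bb.integrable hg' _).const_mul _),
        integral_const_mul, integral_const_mul, hgC, hgC', ← add_mul, hab, one_mul]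
  exact (hsub hg).2

theorem act_mem_tailHull [TopologicalSpace X] [AddCommSemigroup T] [LE T]
    (hP : IsMarkovFellerSemigroup P) (hle : ∀ s t : T, s ≤ s + t)
    {f : X → ℝ} (hf : f ∈ Bb X) {g : X → ℝ} (hg : g ∈ orbitHull P f) (s : T) :
    act (P s) g ∈ tailHull P f s := by
  have hsub : orbitHull P f ⊆ {g | g ∈ Bb X ∧ act (P s) g ∈ tailHull P f s} := by
    refine convexHull_min ?_ ?_
    · rintro _ ⟨t, rfl⟩
      refine ⟨(hP.operator t).act_mem hf, subset_convexHull ℝ _ ⟨s + t, hle s t, ?_⟩⟩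
      rw [add_comm, hP.act_add _ _ hf]
    · rintro g ⟨hg, hgC⟩ g' ⟨hg', hgC'⟩ a b ha hb hab
      have hag := (Bb X).smul_mem a hg
      have hbg := (Bb X).smul_mem b hg'
      refine ⟨(Bb X).add_mem hag hbg, ?_⟩
      have : act (P s) (a • g + b • g') = a • act (P s) g + b • act (P s) g' := by
        funext x
        have h1 := (hP.operator s).act_add hag hbg x
        have h2 := (hP.operator s).act_const_mul a g x
        have h3 := (hP.operator s).act_const_mul b g' x
        change act (P s) (a • g) x = _ at h2
        change act (P s) (b • g') x = _ at h3
        rw [h2, h3] at h1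
        exact h1
      rw [this]
      exact convex_convexHull ℝ _ hgC hgC' ha hb hab
  exact (hsub hg).2

/-- The parallelogram identity: two functions in a convex set whose mean squares are close to the
infimum `d` are close to each other in mean. -/
theorem integral_abs_sub_le_of_near_min {ν : Measure X} [IsProbabilityMeasure ν]
    {K : Set (X → ℝ)} (hK : Convex ℝ K) (hKb : K ⊆ Bb X) {d : ℝ}
    (hd : ∀ g ∈ K, d ≤ ∫ x, g x ^ 2 ∂ν) {g g' : X → ℝ} (hg : g ∈ K) (hg' : g' ∈ K) {η : ℝ}
    (hη : 0 ≤ η) (h1 : ∫ x, g x ^ 2 ∂ν ≤ d + η ^ 2) (h2 : ∫ x, g' x ^ 2 ∂ν ≤ d + η ^ 2) :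
    ∫ x, |g x - g' x| ∂ν ≤ 2 * η := by
  have hsq : ∀ {g : X → ℝ}, g ∈ Bb X → Integrable (fun x => g x ^ 2) ν := fun hg => by
    simpa [sq] using Bb.integrable (Bb.mul hg hg) ν
  have hbg := hKb hg
  have hbg' := hKb hg'
  have hmid := hd _ (hK hg hg' (a := 1 / 2) (b := 1 / 2) (by norm_num) (by norm_num) (by norm_num))
  have hbm := hKb (hK hg hg' (a := 1 / 2) (b := 1 / 2) (by norm_num) (by norm_num) (by norm_num))
  set m : X → ℝ := (1 / 2 : ℝ) • g + (1 / 2 : ℝ) • g' with hm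
  have hdiff : (fun x => g x - g' x) ∈ Bb X := (Bb X).sub_mem hbg hbg'
  have hpar : ∫ x, (g x - g' x) ^ 2 ∂ν =
      2 * ∫ x, g x ^ 2 ∂ν + 2 * ∫ x, g' x ^ 2 ∂ν - 4 * ∫ x, m x ^ 2 ∂ν := by
    have k1 := (hsq hbg).const_mul 2
    have k2 := (hsq hbg').const_mul 2
    have k3 := (hsq hbm).const_mul 4
    rw [← integral_const_mul, ← integral_const_mul, ← integral_const_mul, ← integral_add k1 k2,
      ← integral_sub (f := fun x => 2 * g x ^ 2 + 2 * g' x ^ 2) (k1.add k2) k3]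
    congr 1
    funext x
    simp only [hm, Pi.add_apply, Pi.smul_apply, smul_eq_mul]
    ring
  have hcs := sq_integral_le (Bb.abs hdiff) ν
  simp only [sq_abs] at hcs
  have h4 : (∫ x, |g x - g' x| ∂ν) ^ 2 ≤ (2 * η) ^ 2 := by
    rw [hpar] at hcs
    linarith
  exact (abs_le.1 (abs_le_of_sq_le_sq h4 (by positivity))).2

/-- A mean ergodic theorem along a sequence: for an ergodic measure `μ`, suitable convex
combinations of the functions `P_t f`, with `t` beyond any prescribed times, converge to `∫ f dμ`
almost everywhere. They are chosen to minimize the norm of `L²(μ)` asymptotically; the limit is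
invariant because the minimizer of a convex set is unique and each `P_t` is a contraction. -/
theorem IsErgodicMeasure.exists_seq_tailHull_tendsto [TopologicalSpace X]
    [AddCommSemigroup T] [LE T] (hP : IsMarkovFellerSemigroup P)
    {μ : ProbabilityMeasure X} (hμ : IsErgodicMeasure P μ) (hle : ∀ s t : T, s ≤ s + t)
    {f : X → ℝ} (hf : f ∈ Bb X) (s : ℕ → T) :
    ∃ h : ℕ → X → ℝ, (∀ k, h k ∈ tailHull P f (s k)) ∧ ∀ᵐ x ∂(μ : Measure X),
      Tendsto (fun k => h k x) atTop (𝓝 (∫ x, f x ∂(μ : Measure X))) := by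
  obtain ⟨C, hC⟩ := hf.2
  set K := orbitHull P f with hKdef
  have hK : Convex ℝ K := convex_convexHull ℝ _
  have hKB : ∀ g ∈ K, g ∈ Bb X ∧ ∀ x, |g x| ≤ C := fun g hg => orbitHull_mem_bounded hP hf hC hg
  have hKb : K ⊆ Bb X := fun g hg => (hKB g hg).1
  set q : (X → ℝ) → ℝ := fun g => ∫ x, g x ^ 2 ∂(μ : Measure X) with hq
  set d := sInf (q '' K) with hd
  have hbdd : BddBelow (q '' K) := ⟨0, by
    rintro _ ⟨g, -, rfl⟩
    exact integral_nonneg fun x => sq_nonneg _⟩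
  have hdle : ∀ g ∈ K, d ≤ ∫ x, g x ^ 2 ∂(μ : Measure X) := fun g hg =>
    csInf_le hbdd ⟨g, hg, rfl⟩
  have hne : (q '' K).Nonempty := ⟨_, _, subset_convexHull ℝ _ ⟨s 0, rfl⟩, rfl⟩
  set η : ℕ → ℝ := fun k => (1 / 2) ^ (k + 2) with hη
  have hηpos : ∀ k, 0 < η k := fun k => by positivity
  have hηlim : Tendsto η atTop (𝓝 0) :=
    (tendsto_pow_atTop_nhds_zero_of_lt_one (by norm_num) (by norm_num)).comp
      (tendsto_add_atTop_nat 2)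
  have hηanti : Antitone η := fun a b hab =>
    pow_le_pow_of_le_one (by norm_num) (by norm_num) (by omega)
  have hex : ∀ k, ∃ g ∈ K, q g ≤ d + η k ^ 2 := by
    intro k
    obtain ⟨_, ⟨g, hg, rfl⟩, hlt⟩ := exists_lt_of_csInf_lt hne
      (lt_add_of_pos_right d (pow_pos (hηpos k) 2))
    exact ⟨g, hg, hlt.le⟩
  have hcontr : ∀ g ∈ Bb X, ∀ t, q (act (P t) g) ≤ q g := by
    intro g hg t
    have hsq : (fun x => g x ^ 2) ∈ Bb X := by simpa [sq] using Bb.mul hg hg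
    have h1 := (hP.operator t).act_mem hg
    have := (hP.operator t).integral_eq hsq μ.toFiniteMeasure
    rw [hμ.invariant] at this
    change ∫ x, g x ^ 2 ∂(μ : Measure X) = ∫ x, _ ∂(μ : Measure X) at this
    simp only [hq]
    rw [this]
    refine integral_mono ?_ (Bb.integrable ((hP.operator t).act_mem hsq) _)
      fun x => (hP.operator t).sq_act_le hg x
    simpa [sq] using Bb.integrable (Bb.mul h1 h1) (μ : Measure X)
  choose g hgK hgq using hex
  set h : ℕ → X → ℝ := fun k => act (P (s k)) (g k) with hh
  have hhT : ∀ k, h k ∈ tailHull P f (s k) := fun k => act_mem_tailHull hP hle hf (hgK k) _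
  have hhK : ∀ k, h k ∈ K := fun k => tailHull_subset_orbitHull f _ (hhT k)
  have hhq : ∀ k, q (h k) ≤ d + η k ^ 2 := fun k => (hcontr _ (hKb (hgK k)) _).trans (hgq k)
  have hsqmono : ∀ {N n : ℕ}, N ≤ n → d + η n ^ 2 ≤ d + η N ^ 2 := fun hNn => by
    have := pow_le_pow_left₀ (hηpos _).le (hηanti hNn) 2
    linarith
  have hcauchy : ∀ N n m : ℕ, N ≤ n → N ≤ m →
      eLpNorm (h n - h m) 1 (μ : Measure X) < (2⁻¹ : ENNReal) ^ N := by
    intro N n m hn hm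
    have hb := integral_abs_sub_le_of_near_min hK hKb hdle (hhK n) (hhK m) (hηpos N).le
      ((hhq n).trans (hsqmono hn)) ((hhq m).trans (hsqmono hm))
    rw [eLpNorm_one_eq_lintegral_enorm, ← ofReal_integral_norm_eq_lintegral_enorm
      (Bb.integrable ((Bb X).sub_mem (hKb (hhK n)) (hKb (hhK m))) _)]
    have hlt : ∫ x, ‖(h n - h m) x‖ ∂(μ : Measure X) < (1 / 2 : ℝ) ^ N := by
      refine lt_of_le_of_lt hb ?_
      have : 0 < (1 / 2 : ℝ) ^ N := by positivity
      simp only [hη, pow_add]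
      linarith
    refine (ENNReal.ofReal_lt_ofReal_iff (by positivity)).2 hlt |>.trans_eq ?_
    rw [ENNReal.ofReal_pow (by norm_num), one_div, ENNReal.ofReal_inv_of_pos (by norm_num)]
    simp
  have hae := Lp.ae_tendsto_of_cauchy_eLpNorm
    (fun n => (hKb (hhK n)).1.aestronglyMeasurable) le_rfl
    (by rw [ENNReal.tsum_geometric]; simp) hcauchy
  obtain ⟨h₀, h₀m, h₀lim⟩ := measurable_limit_of_tendsto_metrizable_ae
    (fun n => (hKb (hhK n)).1.aemeasurable) hae
  -- truncating changes the limit on a null set only and makes it bounded everywhere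
  set w : X → ℝ := fun x => max (-C) (min C (h₀ x)) with hw
  have hC0 : ∀ x : X, 0 ≤ C := fun x => (abs_nonneg _).trans (hC x)
  have hwb : ∀ x, |w x| ≤ C := fun x =>
    abs_le.2 ⟨le_max_left _ _, max_le (by linarith [hC0 x]) (min_le_left _ _)⟩
  have hwB : w ∈ Bb X := ⟨measurable_const.max (measurable_const.min h₀m), C, hwb⟩
  have hwlim : ∀ᵐ x ∂(μ : Measure X), Tendsto (fun k => h k x) atTop (𝓝 (w x)) := by
    filter_upwards [h₀lim] with x hx
    have h1 : |h₀ x| ≤ C :=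
      le_of_tendsto hx.abs (Eventually.of_forall fun k => (hKB _ (hhK k)).2 x)
    have : w x = h₀ x := by
      simp only [hw]
      rw [min_eq_right (abs_le.1 h1).2, max_eq_right (abs_le.1 h1).1]
    rwa [this]
  have hL1 : Tendsto (fun k => ∫ x, |w x - h k x| ∂(μ : Measure X)) atTop (𝓝 0) := by
    have h0 : ∫ x, (0 : ℝ) ∂(μ : Measure X) = 0 := by simp
    rw [← h0]
    refine tendsto_integral_of_dominated_convergence (fun _ => 2 * C)
      (fun n => (Bb.abs ((Bb X).sub_mem hwB (hKb (hhK n)))).1.aestronglyMeasurable)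
      (integrable_const _) (fun n => ae_of_all _ fun x => ?_) ?_
    · have h1 := abs_le.1 (hwb x)
      have h2 := abs_le.1 ((hKB _ (hhK n)).2 x)
      simp only [Real.norm_eq_abs, abs_abs]
      exact abs_le.2 ⟨by linarith, by linarith⟩
    · filter_upwards [hwlim] with x hx
      simpa using ((tendsto_const_nhds (x := w x)).sub hx).abs
  have hwinv : ∀ t, act (P t) w =ᵐ[(μ : Measure X)] w := by
    intro t
    have hPt := hP.operator t
    have hPw := hPt.act_mem hwB
    have hbound : ∀ k, ∫ x, |act (P t) w x - w x| ∂(μ : Measure X) ≤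
        2 * (∫ x, |w x - h k x| ∂(μ : Measure X)) + 2 * η k := by
      intro k
      have hhk := hKb (hhK k)
      have hPh := hPt.act_mem hhk
      have hdif := (Bb X).sub_mem hwB hhk
      have i1 : ∫ x, act (P t) (fun y => |w y - h k y|) x ∂(μ : Measure X) =
          ∫ x, |w x - h k x| ∂(μ : Measure X) := by
        have := hPt.integral_eq (Bb.abs hdif) μ.toFiniteMeasure
        rw [hμ.invariant] at this
        exact this.symm
      have i2 : ∫ x, |act (P t) (h k) x - h k x| ∂(μ : Measure X) ≤ 2 * η k := by
        refine integral_abs_sub_le_of_near_min hK hKb hdle ?_ (hhK k) (hηpos k).le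
          ((hcontr _ hhk t).trans (hhq k)) (hhq k)
        exact tailHull_subset_orbitHull f _ (act_mem_tailHull hP hle hf (hhK k) t)
      have j1 := Bb.integrable (hPt.act_mem (Bb.abs hdif)) (μ : Measure X)
      have j2 := Bb.integrable (Bb.abs ((Bb X).sub_mem hPh hhk)) (μ : Measure X)
      have j3 := Bb.integrable (Bb.abs hdif) (μ : Measure X)
      calc ∫ x, |act (P t) w x - w x| ∂(μ : Measure X)
          ≤ ∫ x, (act (P t) (fun y => |w y - h k y|) x + |act (P t) (h k) x - h k x|
              + |w x - h k x|) ∂(μ : Measure X) := by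
            refine integral_mono (Bb.integrable (Bb.abs ((Bb X).sub_mem hPw hwB)) _)
              ((j1.add j2).add j3) fun x => ?_
            have := hPt.abs_act_le (fun y => w y - h k y) x
            rw [hPt.act_sub hwB hhk] at this
            have e : act (P t) w x - w x = (act (P t) w x - act (P t) (h k) x)
              + (act (P t) (h k) x - h k x) - (w x - h k x) := by ring
            simp only []
            rw [e]
            refine (abs_sub _ _).trans (add_le_add ((abs_add_le _ _).trans ?_) le_rfl)
            exact add_le_add this le_rfl
        _ = (∫ x, |w x - h k x| ∂(μ : Measure X)) +
            (∫ x, |act (P t) (h k) x - h k x| ∂(μ : Measure X)) +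
            ∫ x, |w x - h k x| ∂(μ : Measure X) := by
            have e1 := integral_add (j1.add j2) j3
            have e2 := integral_add j1 j2
            simp only [Pi.add_apply] at e1 e2
            exact e1.trans (congrArg (· + _) (e2.trans (congrArg (· + _) i1)))
        _ ≤ _ := by linarith
    have hzero : ∫ x, |act (P t) w x - w x| ∂(μ : Measure X) ≤ 0 := by
      have hlim := (hL1.const_mul 2).add (hηlim.const_mul 2)
      rw [mul_zero, add_zero] at hlim
      exact ge_of_tendsto' hlim hbound
    have hz := (integral_eq_zero_iff_of_nonneg (fun x => abs_nonneg _)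
      (Bb.integrable (Bb.abs ((Bb X).sub_mem hPw hwB)) _)).1
      (le_antisymm hzero (integral_nonneg fun x => abs_nonneg _))
    filter_upwards [hz] with x hx
    exact sub_eq_zero.1 (abs_eq_zero.1 hx)
  have hwc := hμ.ae_eq_integral hP hwB hwinv
  have hint : ∫ x, w x ∂(μ : Measure X) = ∫ x, f x ∂(μ : Measure X) := by
    refine tendsto_nhds_unique (f := fun k => ∫ x, h k x ∂(μ : Measure X)) (l := atTop) ?_ ?_
    · exact tendsto_integral_of_dominated_convergence (fun _ => C)
        (fun n => (hKb (hhK n)).1.aestronglyMeasurable) (integrable_const _)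
        (fun n => ae_of_all _ fun x => (hKB _ (hhK n)).2 x) hwlim
    · simp only [integral_orbitHull hP hμ.invariant hf (hhK _)]
      exact tendsto_const_nhds
  refine ⟨h, hhT, ?_⟩
  filter_upwards [hwlim, hwc] with x hx hx'
  rw [← hint, ← hx']
  exact hx

end MeanErgodic

/-! ### Convergence of the averages at every point -/

/-- The properties of the time sets `ℕ+` and `ℝ≥0` used below: times increase under addition,
sufficiently late times are of the form `n + s` with `s ≥ m`, and there is a cofinal sequence. -/
structure IsTimeSet (T : Type*) [AddCommSemigroup T] [LinearOrder T] : Prop where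
  le_add : ∀ s t : T, s ≤ s + t
  exists_add : ∀ n m : T, ∃ N, ∀ t, N ≤ t → ∃ s, m ≤ s ∧ t = n + s
  exists_seq : ∃ s : ℕ → T, ∀ t, ∀ᶠ k in atTop, t ≤ s k

theorem IsBoundedLipschitz.mem_Bb {X : Type*} [PseudoMetricSpace X] [MeasurableSpace X]
    [OpensMeasurableSpace X] {f : X → ℝ} (hf : IsBoundedLipschitz f) : f ∈ Bb X :=
  ⟨hf.1.choose_spec.continuous.measurable, hf.2⟩

section Averages

variable {X : Type*} [PseudoMetricSpace X] [MeasurableSpace X] [OpensMeasurableSpace X]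
  {T : Type*} [AddCommSemigroup T] [LinearOrder T] {P : T → FiniteMeasure X → FiniteMeasure X}

/-- Under eventual continuity, the almost everywhere convergence in
`IsErgodicMeasure.exists_seq_tailHull_tendsto` improves to convergence everywhere: every ball
contains a point of convergence, and late averages at nearby points are close. -/
theorem exists_seq_tailHull_tendsto_everywhere (hT : IsTimeSet T)
    (hP : IsMarkovFellerSemigroup P) {μ : ProbabilityMeasure X}
    [(μ : Measure X).IsOpenPosMeasure] (hμ : IsErgodicMeasure P μ)
    (hE : ∀ z, EventuallyContinuousAt P z) {f : X → ℝ} (hf : IsBoundedLipschitz f) :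
    ∃ h : ℕ → X → ℝ, (∀ k, h k ∈ orbitHull P f) ∧
      ∀ z, Tendsto (fun k => h k z) atTop (𝓝 (∫ x, f x ∂(μ : Measure X))) := by
  obtain ⟨s, hs⟩ := hT.exists_seq
  obtain ⟨h, hh, hlim⟩ := hμ.exists_seq_tailHull_tendsto hP hT.le_add hf.mem_Bb s
  refine ⟨h, fun k => tailHull_subset_orbitHull f _ (hh k), fun z => ?_⟩
  rw [Metric.tendsto_atTop']
  intro ε hε
  obtain ⟨δ, hδ, hball⟩ := hE z f hf (ε / 2) (half_pos hε)
  obtain ⟨x, hxball, hx⟩ :=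
    (Measure.dense_of_ae hlim).exists_mem_open Metric.isOpen_ball (Metric.nonempty_ball.2 hδ)
      |>.imp fun x hx => hx.symm
  obtain ⟨t₀, ht₀⟩ := hball x hxball
  have h1 : ∀ᶠ k in atTop, |h k x - h k z| < ε / 2 := by
    filter_upwards [hs t₀] with k hk
    have hsub : tailHull P f (s k) ⊆ {g | |g x - g z| < ε / 2} := by
      refine convexHull_min ?_ ?_
      · rintro _ ⟨t, ht, rfl⟩
        exact ht₀ t (hk.trans ht)
      · rintro g hg g' hg' a b ha hb hab
        have h1 := abs_lt.1 (show |g x - g z| < ε / 2 from hg)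
        have h2 := abs_lt.1 (show |g' x - g' z| < ε / 2 from hg')
        obtain rfl : b = 1 - a := by linarith
        simp only [Set.mem_ofPred_eq, Pi.add_apply, Pi.smul_apply, smul_eq_mul, abs_lt]
        rcases eq_or_lt_of_le ha with rfl | ha'
        · constructor <;> linarith
        · constructor <;> nlinarith
    exact hsub (hh k)
  have h2 := (Metric.tendsto_nhds.1 hx) (ε / 2) (half_pos hε)
  obtain ⟨N, hN⟩ := eventually_atTop.1 (h1.and h2)
  refine ⟨N, fun k hk => ?_⟩
  obtain ⟨a1, a2⟩ := hN k hk.le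
  rw [Real.dist_eq] at a2 ⊢
  rw [abs_sub_comm] at a1
  have e : h k z - ∫ x, f x ∂(μ : Measure X) =
      (h k z - h k x) + (h k x - ∫ x, f x ∂(μ : Measure X)) := by ring
  rw [e]
  linarith [abs_add_le (h k z - h k x) (h k x - ∫ x, f x ∂(μ : Measure X))]

/-- Every finite measure charges `f`, at some time, with any proportion of its mass smaller than
`∫ f dμ`. -/
theorem exists_time_le_integral (hT : IsTimeSet T)
    (hP : IsMarkovFellerSemigroup P) {μ : ProbabilityMeasure X}
    [(μ : Measure X).IsOpenPosMeasure] (hμ : IsErgodicMeasure P μ)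
    (hE : ∀ z, EventuallyContinuousAt P z) {f : X → ℝ} (hf : IsBoundedLipschitz f) {α : ℝ}
    (hα : α < ∫ x, f x ∂(μ : Measure X)) (ν : FiniteMeasure X) :
    ∃ t, α * ν.mass ≤ ∫ x, act (P t) f x ∂(ν : Measure X) := by
  by_contra! hcon
  obtain ⟨C, hC⟩ := hf.2
  have hm : (ν : Measure X).real Set.univ = ν.mass := rfl
  obtain ⟨h, hh, hlim⟩ := exists_seq_tailHull_tendsto_everywhere hT hP hμ hE hf
  have hB := fun k => orbitHull_mem_bounded hP hf.mem_Bb hC (hh k)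
  have hlt : ∀ k, ∫ x, h k x ∂(ν : Measure X) < α * ν.mass := by
    intro k
    have hsub : orbitHull P f ⊆ {g | g ∈ Bb X ∧ ∫ x, g x ∂(ν : Measure X) < α * ν.mass} := by
      refine convexHull_min ?_ ?_
      · rintro _ ⟨t, rfl⟩
        exact ⟨(hP.operator t).act_mem hf.mem_Bb, hcon t⟩
      · rintro g ⟨hg, h1⟩ g' ⟨hg', h2⟩ a b ha hb hab
        refine ⟨(Bb X).add_mem ((Bb X).smul_mem a hg) ((Bb X).smul_mem b hg'), ?_⟩
        simp only [Pi.add_apply, Pi.smul_apply, smul_eq_mul]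
        rw [integral_add ((Bb.integrable hg _).const_mul _) ((Bb.integrable hg' _).const_mul _),
          integral_const_mul, integral_const_mul]
        obtain rfl : b = 1 - a := by linarith
        rcases eq_or_lt_of_le ha with rfl | ha'
        · linarith
        · nlinarith
    exact (hsub (hh k)).2
  have hint : Tendsto (fun k => ∫ x, h k x ∂(ν : Measure X)) atTop
      (𝓝 ((∫ x, f x ∂(μ : Measure X)) * ν.mass)) := by
    have : ∫ _, (∫ x, f x ∂(μ : Measure X)) ∂(ν : Measure X) =
        (∫ x, f x ∂(μ : Measure X)) * ν.mass := by
      rw [integral_const, hm, smul_eq_mul, mul_comm]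
    rw [← this]
    exact tendsto_integral_of_dominated_convergence (fun _ => C)
      (fun n => (hB n).1.1.aestronglyMeasurable) (integrable_const _)
      (fun n => ae_of_all _ fun x => (hB n).2 x) (ae_of_all _ hlim)
  have hle := le_of_tendsto' hint fun k => (hlt k).le
  have hmass : (ν.mass : ℝ) ≤ 0 := by
    by_contra! hpos
    nlinarith
  have hν : ν = 0 := (FiniteMeasure.mass_zero_iff ν).1 (NNReal.coe_eq_zero.1
    (le_antisymm hmass ν.mass.coe_nonneg))
  have := hlt 0
  simp [hν] at this

end Averages

/-! ### A ball of equicontinuity -/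

/-- By the Baire category theorem, eventual continuity at a single point already forces the orbit
functions `P_t f` to be uniformly close, from some time on, to functions of time alone on some
nonempty open set. -/
theorem EventuallyContinuousAt.exists_isOpen {X : Type*} [PseudoMetricSpace X] [CompleteSpace X]
    [MeasurableSpace X] [OpensMeasurableSpace X] {T : Type*} [AddCommSemigroup T] [LinearOrder T]
    {P : T → FiniteMeasure X → FiniteMeasure X} (hT : IsTimeSet T)
    (hP : IsMarkovFellerSemigroup P) {z : X} (hE : EventuallyContinuousAt P z) {f : X → ℝ}
    (hf : IsBoundedLipschitz f) {ε : ℝ} (hε : 0 < ε) :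
    ∃ U : Set X, IsOpen U ∧ U.Nonempty ∧ ∃ N, ∀ t, N ≤ t → ∀ x ∈ U,
      |act (P t) f x - act (P t) f z| ≤ ε := by
  obtain ⟨s, hs⟩ := hT.exists_seq
  obtain ⟨δ, hδ, hball⟩ := hE f hf ε hε
  obtain ⟨⟨K, hK⟩, C, hC⟩ := hf
  have hcont : ∀ t, Continuous (act (P t) f) := fun t =>
    (hP.operator t).feller (.ofNormedAddCommGroup f hK.continuous C hC)
  set F : ℕ → Set X := fun k => {x | ∀ t, s k ≤ t → |act (P t) f x - act (P t) f z| ≤ ε}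
  have hF : ∀ k, IsClosed (F k) := by
    intro k
    simp only [F, Set.ofPred_forall]
    exact isClosed_iInter fun t => isClosed_iInter fun _ =>
      isClosed_le ((hcont t).sub continuous_const).abs continuous_const
  have hdense := dense_iUnion_interior_of_closed
    (f := fun k => F k ∪ (Metric.ball z δ)ᶜ)
    (fun k => (hF k).union Metric.isOpen_ball.isClosed_compl) (by
      refine Set.eq_univ_of_forall fun x => Set.mem_iUnion.2 ?_
      by_cases hx : x ∈ Metric.ball z δ
      · obtain ⟨t₀, ht₀⟩ := hball x hx
        obtain ⟨k, hk⟩ := (hs t₀).exists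
        exact ⟨k, Or.inl fun t ht => (ht₀ t (hk.trans ht)).le⟩
      · exact ⟨0, Or.inr hx⟩)
  obtain ⟨y, hyi, hy⟩ := hdense.exists_mem_open Metric.isOpen_ball (Metric.nonempty_ball.2 hδ)
  obtain ⟨k, hk⟩ := Set.mem_iUnion.1 hyi
  refine ⟨_, isOpen_interior.inter Metric.isOpen_ball, ⟨y, hk, hy⟩, s k, fun t ht x hx => ?_⟩
  rcases interior_subset hx.1 with h | h
  · exact h t ht
  · exact absurd hx.2 h

/-! ### Splitting off mass -/

section Splitting

theorem mass_eq_integral {X : Type*} [MeasurableSpace X]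
    (ν : FiniteMeasure X) : (ν.mass : ℝ) = ∫ _, 1 ∂(ν : Measure X) := by
  rw [integral_const, smul_eq_mul, mul_one]
  rfl

theorem abs_integral_le_mul_mass {X : Type*} [MeasurableSpace X]
    (ν : FiniteMeasure X) {g : X → ℝ} {C : ℝ} (h : ∀ x, |g x| ≤ C) :
    |∫ x, g x ∂(ν : Measure X)| ≤ C * ν.mass := by
  rw [← Real.norm_eq_abs]
  exact norm_integral_le_of_norm_le_const (ae_of_all _ h)

variable {X : Type*} [TopologicalSpace X] [MeasurableSpace X] [OpensMeasurableSpace X]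

/-- The finite measure `φ · ν`. -/
noncomputable def weight (φ : X →ᵇ ℝ≥0) (ν : FiniteMeasure X) : FiniteMeasure X :=
  ⟨(ν : Measure X).withDensity fun x => φ x,
    isFiniteMeasure_withDensity (φ.lintegral_lt_top_of_nnreal _).ne⟩

theorem integral_weight (φ : X →ᵇ ℝ≥0) (ν : FiniteMeasure X) (g : X → ℝ) :
    ∫ x, g x ∂(weight φ ν : Measure X) = ∫ x, φ x * g x ∂(ν : Measure X) :=
  integral_withDensity_eq_integral_smul φ.continuous.measurable g

theorem mass_weight (φ : X →ᵇ ℝ≥0) (ν : FiniteMeasure X) :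
    ((weight φ ν).mass : ℝ) = ∫ x, (φ x : ℝ) ∂(ν : Measure X) := by
  rw [mass_eq_integral, integral_weight]
  simp

theorem Bb.coe_nnreal (φ : X →ᵇ ℝ≥0) : (fun x => (φ x : ℝ)) ∈ Bb X :=
  ⟨φ.continuous.measurable.coe_nnreal_real, nndist φ 0, fun x => by
    rw [NNReal.abs_eq, NNReal.coe_le_coe]
    exact BoundedContinuousFunction.NNReal.upper_bound φ x⟩

theorem tendsto_weight {ι : Type*} {l : Filter ι} {κ : ι → FiniteMeasure X}
    {κ₀ : FiniteMeasure X} (h : Tendsto κ l (𝓝 κ₀)) (φ : X →ᵇ ℝ≥0) :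
    Tendsto (fun i => weight φ (κ i)) l (𝓝 (weight φ κ₀)) := by
  rw [FiniteMeasure.tendsto_iff_forall_integral_tendsto] at h ⊢
  intro g
  simp only [integral_weight]
  have hb := Bb.mul (Bb.coe_nnreal φ) (Bb.of_boundedContinuous g)
  exact h (.ofNormedAddCommGroup (fun x => φ x * g x) (by fun_prop) _ hb.2.choose_spec)

theorem IsMarkovFellerOperator.tendsto {P : FiniteMeasure X → FiniteMeasure X}
    (hP : IsMarkovFellerOperator P) {ι : Type*} {l : Filter ι} {κ : ι → FiniteMeasure X}
    {κ₀ : FiniteMeasure X} (h : Tendsto κ l (𝓝 κ₀)) : Tendsto (fun i => P (κ i)) l (𝓝 (P κ₀)) := by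
  rw [FiniteMeasure.tendsto_iff_forall_integral_tendsto] at h ⊢
  intro g
  have hg := Bb.of_boundedContinuous g
  simp only [hP.integral_eq hg]
  exact h (.ofNormedAddCommGroup (act P g) (hP.feller g) _ (hP.act_mem hg).2.choose_spec)

theorem tendsto_coe_mass {ι : Type*} {l : Filter ι} {κ : ι → FiniteMeasure X}
    {κ₀ : FiniteMeasure X} (h : Tendsto κ l (𝓝 κ₀)) {η : ℝ} (hη : 0 < η) :
    ∀ᶠ i in l, |((κ i).mass : ℝ) - κ₀.mass| < η :=
  Metric.tendsto_nhds.1 ((NNReal.continuous_coe.tendsto _).comp h.mass) η hη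

theorem abs_integral_sub_mul_mass_weight_le (φ : X →ᵇ ℝ≥0) (ν : FiniteMeasure X) {g : X → ℝ}
    (hg : g ∈ Bb X) {c ε : ℝ} (h : ∀ x, φ x ≠ 0 → |g x - c| ≤ ε) :
    |∫ x, g x ∂(weight φ ν : Measure X) - c * (weight φ ν).mass| ≤ ε * (weight φ ν).mass := by
  have hφ := Bb.coe_nnreal φ
  rw [integral_weight, mass_weight, ← integral_const_mul, ← integral_const_mul,
    ← integral_sub (Bb.integrable (Bb.mul hφ hg) _) ((Bb.integrable hφ _).const_mul _)]
  refine abs_integral_le_integral_abs.trans (integral_mono_of_nonneg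
    (ae_of_all _ fun x => abs_nonneg _) ((Bb.integrable hφ _).const_mul _)
    (ae_of_all _ fun x => ?_))
  have e : (φ x : ℝ) * g x - c * φ x = φ x * (g x - c) := by ring
  simp only [e, abs_mul, NNReal.abs_eq]
  by_cases hx : φ x = 0
  · simp [hx]
  · rw [mul_comm ε]
    exact mul_le_mul_of_nonneg_left (h x hx) (φ x).coe_nonneg

variable {T : Type*} [AddCommSemigroup T] [LinearOrder T]
  {P : T → FiniteMeasure X → FiniteMeasure X}

/-- The key estimate. Let `φ` be a weight on whose support the functions `P_t f` are, for late
`t`, within `ε` of a function of time, and suppose that every finite measure brings the fraction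
`α` of its mass into `φ` at some time. Then measures `κ i` converging to `κ₀` have orbits
which pair with `f` almost equally at all late times. At each of the `k` steps the measures
are split into the part weighted by `φ`, on which the pairings nearly agree, and the remainder,
whose mass has shrunk by the factor `1 - α`. -/
theorem exists_time_abs_integral_sub_le (hT : IsTimeSet T) (hP : IsMarkovFellerSemigroup P)
    {f : X → ℝ} (hf : f ∈ Bb X) {C : ℝ} (hC₀ : 0 ≤ C) (hC : ∀ x, |f x| ≤ C) {φ ψ : X →ᵇ ℝ≥0}
    (hφψ : ∀ x, φ x + ψ x = 1) {c : T → ℝ} (hc : ∀ t, |c t| ≤ C) {ε : ℝ} (hε : 0 ≤ ε) {N₀ : T}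
    (hosc : ∀ t, N₀ ≤ t → ∀ x, φ x ≠ 0 → |act (P t) f x - c t| ≤ ε) {α : ℝ} (hα : α ≤ 1)
    (hhit : ∀ ν : FiniteMeasure X, ∃ t,
      α * ν.mass ≤ ∫ x, act (P t) (fun y => (φ y : ℝ)) x ∂(ν : Measure X))
    {ι : Type*} {l : Filter ι} (k : ℕ) {κ : ι → FiniteMeasure X} {κ₀ : FiniteMeasure X}
    (hκ : Tendsto κ l (𝓝 κ₀)) {η : ℝ} (hη : 0 < η) :
    ∃ N, ∀ᶠ i in l, ∀ t, N ≤ t →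
      |∫ x, act (P t) f x ∂(κ i : Measure X) - ∫ x, act (P t) f x ∂(κ₀ : Measure X)| ≤
        (2 * ε + 2 * C * (1 - α) ^ k) * κ₀.mass + η := by
  induction k generalizing κ κ₀ η with
  | zero =>
    refine ⟨N₀, ?_⟩
    filter_upwards [tendsto_coe_mass hκ (η := η / (C + 1)) (by positivity)] with i hi t _
    have hb := (hP.operator t).abs_act_le_of_abs_le hf hC
    have h1 := abs_integral_le_mul_mass (κ i) hb
    have h2 := abs_integral_le_mul_mass κ₀ hb
    have h3 : C * ((κ i).mass - κ₀.mass) ≤ η := by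
      have h4 := (abs_lt.1 hi).2
      rw [lt_div_iff₀ (by positivity)] at h4
      nlinarith
    have h5 : 0 ≤ ε * κ₀.mass := by positivity
    have := abs_sub (∫ x, act (P t) f x ∂(κ i : Measure X)) (∫ x, act (P t) f x ∂(κ₀ : Measure X))
    simp only [pow_zero]
    linarith
  | succ k ih =>
    obtain ⟨n, hn⟩ := hhit κ₀
    have hPn := hP.operator n
    have hφ := Bb.coe_nnreal φ
    have hψ := Bb.coe_nnreal ψ
    have hκn := hPn.tendsto hκ
    obtain ⟨N₁, hN₁⟩ := ih (tendsto_weight hκn ψ) (half_pos hη)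
    obtain ⟨N, hN⟩ := hT.exists_add n (max N₁ N₀)
    refine ⟨N, ?_⟩
    have hsum : ((weight φ (P n κ₀)).mass : ℝ) + (weight ψ (P n κ₀)).mass = κ₀.mass := by
      rw [mass_weight, mass_weight, ← integral_add (Bb.integrable hφ _) (Bb.integrable hψ _),
        ← hPn.markov.mass κ₀, mass_eq_integral]
      congr 1
      funext x
      exact_mod_cast hφψ x
    have hA : α * κ₀.mass ≤ (weight φ (P n κ₀)).mass := by
      rw [mass_weight, hPn.integral_eq hφ]
      exact hn
    have hsplit : ∀ (ν : FiniteMeasure X) (s : T), ∫ x, act (P (n + s)) f x ∂(ν : Measure X) =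
        ∫ x, act (P s) f x ∂(weight φ (P n ν) : Measure X) +
          ∫ x, act (P s) f x ∂(weight ψ (P n ν) : Measure X) := by
      intro ν s
      have hg := (hP.operator s).act_mem hf
      rw [add_comm, hP.act_add s n hf, ← hPn.integral_eq hg, integral_weight, integral_weight,
        ← integral_add (Bb.integrable (Bb.mul hφ hg) _) (Bb.integrable (Bb.mul hψ hg) _)]
      congr 1
      funext x
      rw [← add_mul, ← NNReal.coe_add, hφψ, NNReal.coe_one, one_mul]
    filter_upwards [hN₁, tendsto_coe_mass (tendsto_weight hκn φ) (η := η / (2 * (C + ε + 1)))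
      (by positivity)] with i hi1 hi2 t ht
    obtain ⟨s, hs, rfl⟩ := hN t ht
    have h1 := hi1 s ((le_max_left _ _).trans hs)
    have hg := (hP.operator s).act_mem hf
    have h2 := abs_integral_sub_mul_mass_weight_le φ (P n (κ i)) hg
      (hosc s ((le_max_right _ _).trans hs))
    have h3 := abs_integral_sub_mul_mass_weight_le φ (P n κ₀) hg
      (hosc s ((le_max_right _ _).trans hs))
    rw [hsplit, hsplit]
    set A := ((weight φ (P n (κ i))).mass : ℝ)
    set A₀ := ((weight φ (P n κ₀)).mass : ℝ)
    set B₀ := ((weight ψ (P n κ₀)).mass : ℝ)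
    set I := ∫ x, act (P s) f x ∂(weight φ (P n (κ i)) : Measure X)
    set I₀ := ∫ x, act (P s) f x ∂(weight φ (P n κ₀) : Measure X)
    set J := ∫ x, act (P s) f x ∂(weight ψ (P n (κ i)) : Measure X)
    set J₀ := ∫ x, act (P s) f x ∂(weight ψ (P n κ₀) : Measure X)
    have hcA : |c s * (A - A₀)| + ε * |A - A₀| ≤ η / 2 := by
      rw [lt_div_iff₀ (by positivity)] at hi2
      have h5 : |c s| * |A - A₀| ≤ C * |A - A₀| :=
        mul_le_mul_of_nonneg_right (hc s) (abs_nonneg _)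
      rw [abs_mul]
      nlinarith [abs_nonneg (A - A₀)]
    have hI : |I - I₀| ≤ 2 * ε * A₀ + η / 2 := by
      have h6 : ε * (A - A₀) ≤ ε * |A - A₀| := mul_le_mul_of_nonneg_left (le_abs_self _) hε
      have h7 := abs_le.1 h2
      have h8 := abs_le.1 h3
      have h9 := abs_le.1 (le_refl |c s * (A - A₀)|)
      rw [abs_le]
      constructor <;> nlinarith
    have hB : B₀ ≤ (1 - α) * κ₀.mass := by linarith
    have hpow : 2 * C * (1 - α) ^ k * B₀ ≤ 2 * C * (1 - α) ^ (k + 1) * κ₀.mass := by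
      have h10 : 0 ≤ 2 * C * (1 - α) ^ k := mul_nonneg (by positivity)
        (pow_nonneg (by linarith) _)
      calc 2 * C * (1 - α) ^ k * B₀ ≤ 2 * C * (1 - α) ^ k * ((1 - α) * κ₀.mass) :=
            mul_le_mul_of_nonneg_left hB h10
        _ = _ := by ring
    have htri : |I + J - (I₀ + J₀)| ≤ |I - I₀| + |J - J₀| := by
      rw [show I + J - (I₀ + J₀) = (I - I₀) + (J - J₀) by ring]
      exact abs_add_le _ _
    rw [← hsum] at hpow ⊢
    linarith

end Splitting

/-! ### Eventual continuity and the e-property for measures of full support -/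

/-- The functions `P_t f` with `t` in a bounded set of times are equicontinuous. -/
def ShortTimeEquicontinuous {X : Type*} [TopologicalSpace X] [MeasurableSpace X] {T : Type*}
    [LE T] (P : T → FiniteMeasure X → FiniteMeasure X) : Prop :=
  ∀ (f : X →ᵇ ℝ) (N : T) (z : X), ∀ ε > 0, ∀ᶠ x in 𝓝 z, ∀ t, t ≤ N →
    |act (P t) f x - act (P t) f z| < ε

/-- If an ergodic measure has full support, eventual continuity implies the e-property. -/
theorem ePropertyAt_of_eventuallyContinuous {X : Type*} [PseudoMetricSpace X] [CompleteSpace X]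
    [MeasurableSpace X] [OpensMeasurableSpace X] {T : Type*} [AddCommSemigroup T] [LinearOrder T]
    {P : T → FiniteMeasure X → FiniteMeasure X} (hT : IsTimeSet T)
    (hP : IsMarkovFellerSemigroup P) (hshort : ShortTimeEquicontinuous P)
    {μ : ProbabilityMeasure X} [(μ : Measure X).IsOpenPosMeasure] (hμ : IsErgodicMeasure P μ)
    (hE : ∀ z, EventuallyContinuousAt P z) (z : X) : EPropertyAt P z := by
  intro f hf ε hε
  obtain ⟨C, hC⟩ := hf.2
  have hC₀ : 0 ≤ C := (abs_nonneg _).trans (hC z)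
  obtain ⟨U, hU, ⟨y, hy⟩, N₀, hosc⟩ := (hE z).exists_isOpen hT hP hf (ε := ε / 8) (by positivity)
  obtain ⟨r, hr, hball⟩ := Metric.isOpen_iff.1 hU y hy
  set φ : X →ᵇ ℝ≥0 := thickenedIndicator hr {y} with hφ
  have hφ1 : ∀ x, φ x ≤ 1 := thickenedIndicator_le_one hr {y}
  have hφy : φ y = 1 := thickenedIndicator_one hr {y} rfl
  have hφU : ∀ x, φ x ≠ 0 → x ∈ U := by
    intro x hx
    by_contra hxU
    refine hx (thickenedIndicator_zero hr {y} fun hxy => hxU (hball ?_))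
    rwa [Metric.thickening_singleton] at hxy
  have hφL : IsBoundedLipschitz (fun x => (φ x : ℝ)) :=
    ⟨⟨_, (lipschitzWith_thickenedIndicator hr {y})⟩, (Bb.coe_nnreal φ).2⟩
  have hφint := Bb.integrable (Bb.coe_nnreal φ) (μ : Measure X)
  set a := ∫ x, (φ x : ℝ) ∂(μ : Measure X) with ha
  have hapos : 0 < a := by
    rw [ha, integral_pos_iff_support_of_nonneg (fun x => (φ x).coe_nonneg) hφint]
    refine IsOpen.measure_pos _ ?_ ⟨y, by simp [hφy]⟩
    exact (NNReal.continuous_coe.comp φ.continuous).isOpen_support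
  have ha1 : a ≤ 1 := by
    have : ∫ x, (φ x : ℝ) ∂(μ : Measure X) ≤ ∫ _, (1 : ℝ) ∂(μ : Measure X) :=
      integral_mono hφint (integrable_const _) fun x => by exact_mod_cast hφ1 x
    simpa using this
  have hlim : Tendsto (fun k : ℕ => 2 * C * (1 - a / 2) ^ k) atTop (𝓝 0) := by
    simpa using (tendsto_pow_atTop_nhds_zero_of_lt_one (r := 1 - a / 2) (by linarith)
      (by linarith)).const_mul (2 * C)
  obtain ⟨k, hk⟩ := (hlim.eventually_lt_const (show 0 < ε / 8 by positivity)).exists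
  have hdirac : Tendsto (fun x : X => diracFM x) (𝓝 z) (𝓝 (diracFM z)) :=
    (ProbabilityMeasure.toFiniteMeasure_continuous.comp continuous_diracProba).tendsto z
  obtain ⟨N, hN⟩ := exists_time_abs_integral_sub_le hT hP hf.mem_Bb hC₀ hC (φ := φ) (ψ := 1 - φ)
    (fun x => by simpa using add_tsub_cancel_of_le (hφ1 x)) (c := fun t => act (P t) f z)
    (fun t => (hP.operator t).abs_act_le_of_abs_le hf.mem_Bb hC z) (by positivity)
    (fun t ht x hx => hosc t ht x (hφU x hx)) (α := a / 2) (by linarith)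
    (exists_time_le_integral hT hP hμ hE hφL (by linarith)) k hdirac
    (show 0 < ε / 8 by positivity)
  have hint : ∀ x t, ∫ w, act (P t) f w ∂(diracFM x : Measure X) = act (P t) f x := fun x t =>
    integral_dirac' _ _ ((hP.operator t).act_mem hf.mem_Bb).1.stronglyMeasurable
  have hmass : ((diracFM z).mass : ℝ) = 1 := by
    rw [mass_eq_integral]
    exact integral_dirac' _ _ stronglyMeasurable_const
  obtain ⟨K, hK⟩ := hf.1
  have hev := (hshort (.ofNormedAddCommGroup f hK.continuous C hC) N z ε hε).and hN
  obtain ⟨δ, hδ, hδball⟩ := Metric.eventually_nhds_iff_ball.1 hev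
  refine ⟨δ, hδ, fun x hx t => ?_⟩
  obtain ⟨h1, h2⟩ := hδball x hx
  rcases le_total t N with ht | ht
  · exact h1 t ht
  · have h3 := h2 t ht
    rw [hint, hint, hmass] at h3
    linarith

/-! ### Restriction to an absorbing closed set -/

section Restriction

/-- The Tietze extension theorem for bounded continuous functions. -/
theorem exists_boundedContinuous_extension {X : Type*} [TopologicalSpace X] [NormalSpace X]
    {S : Set X} (hS : IsClosed S) (f : S →ᵇ ℝ) :
    ∃ F : X →ᵇ ℝ, ∀ x : S, F x = f x := by
  obtain ⟨F, -, hF⟩ := BoundedContinuousFunction.exists_norm_eq_domRestrict_eq_of_closed f hS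
  exact ⟨F, fun x => by rw [← hF]; rfl⟩

variable {X : Type*} [MeasurableSpace X] {S : Set X}

theorem map_comap_val (hS : MeasurableSet S) {m : FiniteMeasure X} (hm : (m : Measure X) Sᶜ = 0) :
    (m.comap (Subtype.val : S → X)).map Subtype.val = m := by
  apply FiniteMeasure.toMeasure_injective
  rw [FiniteMeasure.toMeasure_map, FiniteMeasure.toMeasure_comap,
    (MeasurableEmbedding.subtype_coe hS).map_comap, Subtype.range_coe]
  exact Measure.restrict_eq_self_of_ae_mem hm

theorem comap_map_val (hS : MeasurableSet S) (ν : FiniteMeasure S) :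
    (ν.map Subtype.val).comap (Subtype.val : S → X) = ν := by
  apply FiniteMeasure.toMeasure_injective
  rw [FiniteMeasure.toMeasure_comap, FiniteMeasure.toMeasure_map,
    (MeasurableEmbedding.subtype_coe hS).comap_map]

theorem map_val_compl (hS : MeasurableSet S) (ν : FiniteMeasure S) :
    (ν.map Subtype.val : Measure X) Sᶜ = 0 := by
  rw [FiniteMeasure.toMeasure_map, Measure.map_apply measurable_subtype_coe hS.compl]
  simp

theorem integral_comap_val (hS : MeasurableSet S) {m : FiniteMeasure X}
    (hm : (m : Measure X) Sᶜ = 0) {f : S → ℝ} {F : X → ℝ} (hF : ∀ x : S, F x = f x) :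
    ∫ x, f x ∂(m.comap (Subtype.val : S → X) : Measure S) = ∫ x, F x ∂(m : Measure X) := by
  conv_rhs => rw [← map_comap_val hS hm, FiniteMeasure.toMeasure_map,
    (MeasurableEmbedding.subtype_coe hS).integral_map]
  simp only [hF]

theorem diracFM_map_val (x : S) : (diracFM x).map Subtype.val = diracFM (x : X) := by
  apply FiniteMeasure.toMeasure_injective
  exact Measure.map_dirac' measurable_subtype_coe x

theorem extend_mem_Bb (hS : MeasurableSet S) {f : S → ℝ} (hf : f ∈ Bb S) :
    Function.extend Subtype.val f (0 : X → ℝ) ∈ Bb X := by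
  obtain ⟨hm, C, hC⟩ := hf
  refine ⟨(MeasurableEmbedding.subtype_coe hS).measurable_extend hm measurable_const,
    max C 0, fun x => ?_⟩
  by_cases hx : x ∈ S
  · have := Subtype.val_injective.extend_apply f (0 : X → ℝ) ⟨x, hx⟩
    rw [this]
    exact (hC _).trans (le_max_left _ _)
  · rw [Function.extend_apply' _ _ _ (by simpa using hx)]
    simp

variable {T : Type*} {P : T → FiniteMeasure X → FiniteMeasure X}

theorem act_restrictTo (hS : MeasurableSet S) {t : T}
    (habs : ∀ x ∈ S, (P t (diracFM x) : Measure X) Sᶜ = 0) {f : S → ℝ} {F : X → ℝ}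
    (hF : ∀ x : S, F x = f x) (x : S) : act (restrictTo P S t) f x = act (P t) F x := by
  rw [act, restrictTo, diracFM_map_val, integral_comap_val hS (habs x x.2) hF]
  rfl

/-- The trace of an ergodic measure on a set that carries it is ergodic for the restriction. -/
theorem IsErgodicMeasure.restrictTo (hS : MeasurableSet S)
    (habs : ∀ t, ∀ x ∈ S, (P t (diracFM x) : Measure X) Sᶜ = 0)
    {μ : ProbabilityMeasure X} (hμ : IsErgodicMeasure P μ) {ν : ProbabilityMeasure S}
    (hν : (ν : Measure S).map Subtype.val = (μ : Measure X)) :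
    IsErgodicMeasure (restrictTo P S) ν := by
  have hemb := MeasurableEmbedding.subtype_coe hS
  refine ⟨fun t => ?_, fun A hA hinv => ?_⟩
  · have h1 : ν.toFiniteMeasure.map Subtype.val = μ.toFiniteMeasure :=
      FiniteMeasure.toMeasure_injective hν
    rw [MarkovFeller.restrictTo, h1, hμ.invariant, ← h1, comap_map_val hS]
  · have hpre : (Subtype.val : S → X) ⁻¹' (Subtype.val '' A) = A :=
      Set.preimage_image_eq _ Subtype.val_injective
    have hind : ∀ x : S, ((Subtype.val '' A).indicator 1 : X → ℝ) x =
        (A.indicator 1 : S → ℝ) x := by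
      intro x
      by_cases hx : x ∈ A <;> simp [Set.indicator, hx]
    have h2 := hμ.trivial (Subtype.val '' A) (hemb.measurableSet_image.2 hA) fun t => by
      rw [← hν, EventuallyEq, hemb.ae_map_iff]
      filter_upwards [hinv t] with x hx
      rw [← act_restrictTo hS (habs t) hind, hind, hx]
    rwa [← hν, hemb.map_apply, hpre] at h2

variable [TopologicalSpace X]

/-- If `S` carries every `P_t δ_x` with `x ∈ S`, it carries `P_t m` for every measure `m` carried
by `S`. -/
theorem apply_compl_eq_zero (hS : MeasurableSet S) {Q : FiniteMeasure X → FiniteMeasure X}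
    (hQ : IsMarkovFellerOperator Q)
    (habs : ∀ x ∈ S, (Q (diracFM x) : Measure X) Sᶜ = 0) {m : FiniteMeasure X}
    (hm : (m : Measure X) Sᶜ = 0) : (Q m : Measure X) Sᶜ = 0 := by
  have h1 := hQ.integral_eq (Bb.indicator hS.compl) m
  rw [integral_indicator_one hS.compl] at h1
  have h2 : act Q (Sᶜ.indicator 1) =ᵐ[(m : Measure X)] 0 := by
    have : ∀ᵐ x ∂(m : Measure X), x ∈ S := hm
    filter_upwards [this] with x hx
    rw [act, integral_indicator_one hS.compl, measureReal_def, habs x hx]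
    rfl
  rw [integral_congr_ae h2] at h1
  simpa [measureReal_eq_zero_iff] using h1

variable [BorelSpace X] [NormalSpace X]

theorem IsMarkovFellerOperator.restrictTo (hS : IsClosed S) {t : T}
    (hP : IsMarkovFellerOperator (P t))
    (habs : ∀ x ∈ S, (P t (diracFM x) : Measure X) Sᶜ = 0) :
    IsMarkovFellerOperator (restrictTo P S t) := by
  have hSm := hS.measurableSet
  have hcar : ∀ ν : FiniteMeasure S, (P t (ν.map Subtype.val) : Measure X) Sᶜ = 0 := fun ν =>
    apply_compl_eq_zero hSm hP habs (map_val_compl hSm ν)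
  have hext : ∀ (f : S → ℝ) (x : S), Function.extend Subtype.val f (0 : X → ℝ) x = f x :=
    fun f x => Subtype.val_injective.extend_apply _ _ _
  have hmem : ∀ f ∈ Bb S, act (MarkovFeller.restrictTo P S t) f ∈ Bb S := by
    intro f hf
    obtain ⟨hm, C, hC⟩ := hP.act_mem (extend_mem_Bb hSm hf)
    have : act (MarkovFeller.restrictTo P S t) f = fun x : S => act (P t) _ (x : X) :=
      funext fun x => act_restrictTo hSm habs (hext f) x
    rw [this]
    exact ⟨hm.comp measurable_subtype_coe, C, fun x => hC x⟩
  refine ⟨⟨?_, ?_⟩, ⟨⟨⟨fun f => ⟨_, hmem f f.2⟩, ?_⟩, ?_⟩, ?_⟩, ?_⟩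
  · intro a b ν ν'
    simp only [MarkovFeller.restrictTo]
    rw [FiniteMeasure.map_add measurable_subtype_coe, FiniteMeasure.map_smul,
      FiniteMeasure.map_smul, hP.markov.linear]
    apply FiniteMeasure.eq_of_forall_toMeasure_apply_eq
    intro s hs
    have hemb := MeasurableEmbedding.subtype_coe hSm
    simp only [FiniteMeasure.toMeasure_comap, FiniteMeasure.toMeasure_add,
      FiniteMeasure.toMeasure_smul, hemb.comap_apply, Measure.add_apply, Measure.smul_apply]
  · intro ν
    have h1 : ((MarkovFeller.restrictTo P S t ν).map Subtype.val).mass =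
        (MarkovFeller.restrictTo P S t ν).mass := by
      simp [FiniteMeasure.mass, FiniteMeasure.map_apply _ measurable_subtype_coe MeasurableSet.univ]
    have h2 : (ν.map (Subtype.val : S → X)).mass = ν.mass := by
      simp [FiniteMeasure.mass, FiniteMeasure.map_apply _ measurable_subtype_coe MeasurableSet.univ]
    rw [← h1, MarkovFeller.restrictTo, map_comap_val hSm (hcar ν), hP.markov.mass, h2]
  · intro f g
    ext x
    exact integral_add (Bb.integrable f.2 _) (Bb.integrable g.2 _)
  · intro c f
    ext x
    exact integral_const_mul _ _
  · intro f ν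
    have h1 : ∫ x, (f : S → ℝ) x ∂(MarkovFeller.restrictTo P S t ν : Measure S) = _ :=
      integral_comap_val hSm (hcar ν) (hext f)
    rw [h1, hP.integral_eq (extend_mem_Bb hSm f.2), FiniteMeasure.toMeasure_map,
      (MeasurableEmbedding.subtype_coe hSm).integral_map]
    exact integral_congr_ae (ae_of_all _ fun x => (act_restrictTo hSm habs (hext f) x).symm)
  · intro f
    obtain ⟨F, hF⟩ := exists_boundedContinuous_extension hS f
    have : act (MarkovFeller.restrictTo P S t) f = fun x : S => act (P t) F (x : X) :=
      funext fun x => act_restrictTo hSm habs hF x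
    rw [this]
    exact (hP.feller F).comp continuous_subtype_val

theorem IsMarkovFellerSemigroup.restrictTo [Add T] (hS : IsClosed S)
    (hP : IsMarkovFellerSemigroup P)
    (habs : ∀ t, ∀ x ∈ S, (P t (diracFM x) : Measure X) Sᶜ = 0) :
    IsMarkovFellerSemigroup (restrictTo P S) := by
  have hSm := hS.measurableSet
  refine ⟨fun t => (hP.operator t).restrictTo hS (habs t), fun e he ν => ?_, fun s t ν => ?_⟩
  · rw [MarkovFeller.restrictTo, hP.neutral e he, comap_map_val hSm]
  · simp only [MarkovFeller.restrictTo]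
    rw [hP.add, map_comap_val hSm
      (apply_compl_eq_zero hSm (hP.operator t) (habs t) (map_val_compl hSm ν))]

theorem ShortTimeEquicontinuous.restrictTo [LE T] (hS : IsClosed S)
    (hP : ShortTimeEquicontinuous P)
    (habs : ∀ t, ∀ x ∈ S, (P t (diracFM x) : Measure X) Sᶜ = 0) :
    ShortTimeEquicontinuous (restrictTo P S) := by
  intro f N z ε hε
  obtain ⟨F, hF⟩ := exists_boundedContinuous_extension hS f
  filter_upwards [continuous_subtype_val.tendsto z (hP F N z ε hε)] with x hx t ht
  rw [act_restrictTo hS.measurableSet (habs t) hF, act_restrictTo hS.measurableSet (habs t) hF]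
  exact hx t ht

end Restriction

theorem EventuallyContinuousAt.restrictTo {X : Type*} [PseudoMetricSpace X] [MeasurableSpace X]
    [BorelSpace X] {T : Type*} [LE T] {P : T → FiniteMeasure X → FiniteMeasure X} {S : Set X}
    (hS : MeasurableSet S) (habs : ∀ t, ∀ x ∈ S, (P t (diracFM x) : Measure X) Sᶜ = 0) {z : S}
    (hP : EventuallyContinuousAt P (z : X)) : EventuallyContinuousAt (restrictTo P S) z := by
  rintro f ⟨⟨K, hK⟩, C, hC⟩ ε hε
  have hext : ∀ x : S, Function.extend Subtype.val f (0 : X → ℝ) x = f x :=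
    fun x => Subtype.val_injective.extend_apply _ _ _
  have hLip : LipschitzOnWith K (Function.extend Subtype.val f (0 : X → ℝ)) S := by
    intro x hx y hy
    have h1 := hext ⟨x, hx⟩
    have h2 := hext ⟨y, hy⟩
    simp only at h1 h2
    rw [h1, h2]
    exact hK ⟨x, hx⟩ ⟨y, hy⟩
  obtain ⟨g, hg, hgS⟩ := hLip.extend_real
  have hF : ∀ x : S, max (-C) (min C (g x)) = f x := by
    intro x
    have h1 := abs_le.1 (hC x)
    rw [← hgS x.2, hext, min_eq_right h1.2, max_eq_right h1.1]
  have hC₀ : 0 ≤ C := (abs_nonneg _).trans (hC z)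
  obtain ⟨δ, hδ, h⟩ := hP (fun x => max (-C) (min C (g x)))
    ⟨⟨K, (hg.const_min C).const_max (-C)⟩, C, fun x => abs_le.2
      ⟨le_max_left _ _, max_le (by linarith) (min_le_left _ _)⟩⟩ ε hε
  refine ⟨δ, hδ, fun x hx => ?_⟩
  obtain ⟨t₀, ht₀⟩ := h x hx
  refine ⟨t₀, fun t ht => ?_⟩
  rw [act_restrictTo (F := fun y => max (-C) (min C (g y))) hS (habs t) hF,
    act_restrictTo (F := fun y => max (-C) (min C (g y))) hS (habs t) hF]
  exact ht₀ t ht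

/-! ### The support of an invariant measure -/

/-- The support `S` of an invariant measure is absorbing: `P (min 1 (dist · S))` is a continuous
nonnegative function with integral zero, so it vanishes on `S`. -/
theorem IsMarkovFellerOperator.apply_compl_support {X : Type*} [PseudoMetricSpace X]
    [TopologicalSpace.SeparableSpace X] [MeasurableSpace X] [BorelSpace X]
    {P : FiniteMeasure X → FiniteMeasure X} (hP : IsMarkovFellerOperator P)
    {μ : ProbabilityMeasure X} (hμ : P μ.toFiniteMeasure = μ.toFiniteMeasure) {x : X}
    (hx : x ∈ (μ : Measure X).support) :
    (P (diracFM x) : Measure X) (μ : Measure X).supportᶜ = 0 := by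
  have : SecondCountableTopology X := UniformSpace.secondCountable_of_separable X
  set S := (μ : Measure X).support with hS
  have hSc : IsClosed S := Measure.isClosed_support
  set g : X → ℝ := fun y => min 1 (Metric.infDist y S) with hg
  have hg0 : ∀ y, 0 ≤ g y := fun y => le_min zero_le_one Metric.infDist_nonneg
  have hgc : Continuous g := continuous_const.min (Metric.continuous_infDist_pt S)
  have hgb : ∀ y, ‖g y‖ ≤ 1 := fun y => by
    rw [Real.norm_eq_abs, abs_of_nonneg (hg0 y)]
    exact min_le_left _ _
  have hgB : g ∈ Bb X := ⟨hgc.measurable, 1, hgb⟩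
  have hgS : ∀ y, g y = 0 → y ∈ S := by
    intro y hy
    refine (hSc.mem_iff_infDist_zero ⟨x, hx⟩).2 ?_
    rcases min_choice 1 (Metric.infDist y S) with h | h
    · simp only [hg, h] at hy
      norm_num at hy
    · exact h ▸ hy
  have hPg0 : ∀ y, 0 ≤ act P g y := fun y => integral_nonneg hg0
  have hPgc : Continuous (act P g) := hP.feller (.ofNormedAddCommGroup g hgc 1 hgb)
  have hgae : g =ᵐ[(μ : Measure X)] 0 := by
    have : ∀ᵐ y ∂(μ : Measure X), y ∈ S := Measure.support_mem_ae
    filter_upwards [this] with y hy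
    simp [hg, Metric.infDist_zero_of_mem hy]
  have hint : ∫ y, act P g y ∂(μ : Measure X) = 0 := by
    have h1 := hP.integral_eq hgB μ.toFiniteMeasure
    rw [hμ] at h1
    refine h1.symm.trans ?_
    change ∫ y, g y ∂(μ : Measure X) = 0
    rw [integral_congr_ae hgae]
    simp
  have hae := (integral_eq_zero_iff_of_nonneg hPg0 (Bb.integrable (hP.act_mem hgB) _)).1 hint
  have hx0 : act P g x = 0 := by
    by_contra hne
    have hpos : 0 < act P g x := lt_of_le_of_ne (hPg0 x) (Ne.symm hne)
    have hU : {y | 0 < act P g y} ∈ 𝓝 x := (isOpen_lt continuous_const hPgc).mem_nhds hpos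
    refine ((Measure.mem_support_iff_forall x).1 hx _ hU).ne' ?_
    refine measure_mono_null (fun y hy => ?_) (ae_iff.1 hae)
    exact (show 0 < act P g y from hy).ne'
  have h2 := (integral_eq_zero_iff_of_nonneg hg0 (Bb.integrable hgB _)).1 hx0
  exact h2.mono fun y hy => hgS y hy

/-! ### Time sets and short times -/

theorem isTimeSet_pnat : IsTimeSet ℕ+ where
  le_add s t := (PNat.lt_add_right s t).le
  exists_add n m := by
    refine ⟨n + m, fun t ht => ⟨t - n, ?_, ?_⟩⟩
    · have h1 : n < t := (PNat.lt_add_right n m).trans_le ht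
      rw [← PNat.add_sub_of_lt h1] at ht
      exact le_of_add_le_add_left ht
    · exact (PNat.add_sub_of_lt ((PNat.lt_add_right n m).trans_le ht)).symm
  exists_seq := ⟨Nat.succPNat, fun t => by
    filter_upwards [eventually_ge_atTop (t : ℕ)] with k hk
    rw [← PNat.coe_le_coe, Nat.succPNat_coe]
    omega⟩

theorem isTimeSet_nnreal : IsTimeSet ℝ≥0 where
  le_add _ _ := le_self_add
  exists_add n m := ⟨n + m, fun t ht => ⟨t - n, le_tsub_of_add_le_left ht,
    (add_tsub_cancel_of_le (le_self_add.trans ht)).symm⟩⟩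
  exists_seq := ⟨fun k => k, fun t => tendsto_natCast_atTop_atTop.eventually_ge_atTop t⟩

theorem shortTimeEquicontinuous_pnat {X : Type*} [TopologicalSpace X] [MeasurableSpace X]
    {P : ℕ+ → FiniteMeasure X → FiniteMeasure X} (hP : IsMarkovFellerSemigroup P) :
    ShortTimeEquicontinuous P := by
  intro f N z ε hε
  refine (eventually_all_finite (Set.finite_Iic N)).2 fun t _ => ?_
  exact Metric.tendsto_nhds.1 (((hP.operator t).feller f).tendsto z) ε hε

/-- Strong continuity makes `P_t f` uniformly close to `P_{jδ} f`, where `jδ` is the last multiple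
of a small `δ` before `t`; for bounded times only finitely many functions `P_{jδ} f` occur. -/
theorem StronglyContinuous.shortTimeEquicontinuous {X : Type*} [TopologicalSpace X]
    [MeasurableSpace X] [OpensMeasurableSpace X] {P : ℝ≥0 → FiniteMeasure X → FiniteMeasure X}
    (hP : IsMarkovFellerSemigroup P) (hc : StronglyContinuous P) : ShortTimeEquicontinuous P := by
  intro f N z ε hε
  have hε3 : 0 < ε / 3 := by positivity
  have hf := Bb.of_boundedContinuous f
  obtain ⟨δ, hδ, hδf⟩ := mem_nhdsGT_iff_exists_Ioo_subset.1
    (Metric.tendstoUniformly_iff.1 (hc f) (ε / 3) hε3)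
  have hδ' : (0 : ℝ≥0) < δ := hδ
  have hclose : ∀ t : ℝ≥0, ∀ x,
      |act (P t) f x - act (P (⌊t / δ⌋₊ * δ)) f x| ≤ ε / 3 := by
    intro t x
    have hle : (⌊t / δ⌋₊ : ℝ≥0) * δ ≤ t := by
      rw [← le_div_iff₀ hδ']
      exact Nat.floor_le (by positivity)
    have hlt : t < ⌊t / δ⌋₊ * δ + δ := by
      have := Nat.lt_floor_add_one (t / δ)
      rw [div_lt_iff₀ hδ'] at this
      rwa [add_mul, one_mul] at this
    obtain ⟨h, hh⟩ := exists_add_of_le hle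
    rcases eq_or_ne h 0 with rfl | h0
    · rw [add_zero] at hh
      rw [← hh, sub_self, abs_zero]
      exact hε3.le
    · have hhδ : h < δ := by
        rw [hh] at hlt
        refine lt_of_add_lt_add_left (a := (⌊t / δ⌋₊ : ℝ≥0) * δ) ?_
        rwa [← hh] at hlt ⊢
      have hmem := hδf (show h ∈ Set.Ioo 0 δ from ⟨pos_iff_ne_zero.2 h0, hhδ⟩)
      have hPh := (hP.operator h).act_mem hf
      set j : ℝ≥0 := ⌊t / δ⌋₊ * δ with hj
      have e : act (P t) f x = act (P j) (act (P h) f) x := by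
        rw [hh, add_comm, hP.act_add h j hf]
      rw [e, ← (hP.operator j).act_sub hPh hf]
      refine (hP.operator j).abs_act_le_of_abs_le ((Bb X).sub_mem hPh hf) (fun y => ?_) x
      have := hmem y
      rw [dist_comm, Real.dist_eq] at this
      exact this.le
  have hfin : ∀ᶠ x in 𝓝 z, ∀ j ∈ Set.Iic ⌊N / δ⌋₊,
      |act (P (j * δ)) f x - act (P (j * δ)) f z| < ε / 3 := by
    refine (eventually_all_finite (Set.finite_Iic _)).2 fun j _ => ?_
    exact Metric.tendsto_nhds.1 (((hP.operator _).feller f).tendsto z) _ hε3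
  filter_upwards [hfin] with x hx t ht
  have h1 := abs_le.1 (hclose t x)
  have h2 := abs_le.1 (hclose t z)
  have h3 := abs_lt.1 (hx ⌊t / δ⌋₊ (Nat.floor_le_floor (by gcongr)))
  rw [abs_lt]
  constructor <;> linarith

/-! ### The restriction to the support of an ergodic measure -/

/-- The assertions on the support of an ergodic measure, for both time sets at once. -/
theorem restrictTo_support {X : Type*} [MetricSpace X] [CompleteSpace X]
    [TopologicalSpace.SeparableSpace X] [MeasurableSpace X] [BorelSpace X]
    {T : Type*} [AddCommSemigroup T] [LinearOrder T] (hT : IsTimeSet T)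
    {μ : ProbabilityMeasure X} {P : T → FiniteMeasure X → FiniteMeasure X}
    (hP : IsMarkovFellerSemigroup P) (hshort : ShortTimeEquicontinuous P)
    (hμ : IsErgodicMeasure P μ) :
    (∀ t, ∀ x ∈ (μ : Measure X).support,
      (P t (diracFM x) : Measure X) (μ : Measure X).support = 1) ∧
    IsMarkovFellerSemigroup (restrictTo P (μ : Measure X).support) ∧
    ((∀ z, EventuallyContinuousAt P z) →
      ∀ z, EPropertyAt (restrictTo P (μ : Measure X).support) z) ∧
    ((∀ z, EventuallyContinuousAt (restrictTo P (μ : Measure X).support) z) ↔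
      ∀ z, EPropertyAt (restrictTo P (μ : Measure X).support) z) := by
  have : SecondCountableTopology X := UniformSpace.secondCountable_of_separable X
  set S := (μ : Measure X).support with hSdef
  have hS : IsClosed S := Measure.isClosed_support
  have hSm := hS.measurableSet
  have hμS : (μ : Measure X) Sᶜ = 0 := Measure.measure_compl_support
  have habs : ∀ t, ∀ x ∈ S, (P t (diracFM x) : Measure X) Sᶜ = 0 := fun t x hx =>
    (hP.operator t).apply_compl_support (hμ.invariant t) hx
  have hmap : ((μ : Measure X).comap (Subtype.val : S → X)).map Subtype.val = (μ : Measure X) := by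
    rw [(MeasurableEmbedding.subtype_coe hSm).map_comap, Subtype.range_coe]
    exact Measure.restrict_eq_self_of_ae_mem hμS
  have hprob : IsProbabilityMeasure ((μ : Measure X).comap (Subtype.val : S → X)) := by
    constructor
    have h1 : (μ : Measure X) Set.univ = 1 := measure_univ
    rwa [← hmap, Measure.map_apply measurable_subtype_coe MeasurableSet.univ] at h1
  set ν : ProbabilityMeasure S := ⟨_, hprob⟩ with hν
  have hpos : (ν : Measure S).IsOpenPosMeasure := by
    refine ⟨fun U hU hne => ?_⟩
    obtain ⟨V, hV, rfl⟩ := isOpen_induced_iff.1 hU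
    obtain ⟨x, hx⟩ := hne
    have h1 : (ν : Measure S) (Subtype.val ⁻¹' V) = (μ : Measure X) V := by
      rw [← hmap, Measure.map_apply measurable_subtype_coe hV.measurableSet]
      rfl
    rw [h1]
    exact ((Measure.mem_support_iff_forall _).1 x.2 V (hV.mem_nhds hx)).ne'
  have : CompleteSpace S := hS.completeSpace_coe
  have hP' := hP.restrictTo hS habs
  have hkey : (∀ z, EventuallyContinuousAt (restrictTo P S) z) →
      ∀ z, EPropertyAt (restrictTo P S) z := fun hE z =>
    ePropertyAt_of_eventuallyContinuous hT hP' (hshort.restrictTo hS habs)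
      (μ := ν)
      (hμ.restrictTo hSm habs (ν := ν) hmap) hE z
  refine ⟨fun t x hx => ?_, hP', fun hE => hkey fun z => (hE z).restrictTo hSm habs, hkey, ?_⟩
  · have := (hP.operator t).isProbabilityMeasure x
    exact (prob_compl_eq_zero_iff hSm).1 (habs t x hx)
  · intro hE z f hf ε hε
    obtain ⟨δ, hδ, h⟩ := hE z f hf ε hε
    exact ⟨δ, hδ, fun x hx => ⟨hT.exists_seq.choose 0, fun t _ => h x hx t⟩⟩

end MarkovFeller

theorem corollary1 {X : Type*} [MetricSpace X] [CompleteSpace X]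
    [TopologicalSpace.SeparableSpace X] [MeasurableSpace X] [BorelSpace X]
    (μ : ProbabilityMeasure X) :
    -- discrete time
    (∀ P : ℕ+ → FiniteMeasure X → FiniteMeasure X,
      IsMarkovFellerSemigroup P → IsErgodicMeasure P μ →
        (∀ t, ∀ x ∈ (μ : Measure X).support,
          (P t (diracFM x) : Measure X) (μ : Measure X).support = 1) ∧
        IsMarkovFellerSemigroup (restrictTo P (μ : Measure X).support) ∧
        ((∀ z, EventuallyContinuousAt P z) →
          ∀ z, EPropertyAt (restrictTo P (μ : Measure X).support) z) ∧
        ((∀ z, EventuallyContinuousAt (restrictTo P (μ : Measure X).support) z) ↔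
          ∀ z, EPropertyAt (restrictTo P (μ : Measure X).support) z)) ∧
    -- continuous time
    (∀ P : ℝ≥0 → FiniteMeasure X → FiniteMeasure X,
      IsMarkovFellerSemigroup P → StronglyContinuous P → IsErgodicMeasure P μ →
        (∀ t, ∀ x ∈ (μ : Measure X).support,
          (P t (diracFM x) : Measure X) (μ : Measure X).support = 1) ∧
        IsMarkovFellerSemigroup (restrictTo P (μ : Measure X).support) ∧
        ((∀ z, EventuallyContinuousAt P z) →
          ∀ z, EPropertyAt (restrictTo P (μ : Measure X).support) z) ∧
        ((∀ z, EventuallyContinuousAt (restrictTo P (μ : Measure X).support) z) ↔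
          ∀ z, EPropertyAt (restrictTo P (μ : Measure X).support) z)) := by
  exact ⟨fun P hP hμ => restrictTo_support isTimeSet_pnat hP (shortTimeEquicontinuous_pnat hP) hμ,
    fun P hP hc hμ =>
      restrictTo_support isTimeSet_nnreal hP (hc.shortTimeEquicontinuous hP) hμ⟩
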